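/- Let $E\to M$ be a smooth real vector bundle of finite rank over a smooth manifold (Hausdorff, second countable, without boundary) with a Courant algebroid structure: a smooth fibrewise symmetric nondegenerate pairing $\langle\cdot,\cdot\rangle$, a vector bundle morphism $\rho:E\to TM$ and an $\mathbb R$-bilinear bracket $[\cdot,\cdot]$ on $\Gamma(E)$ such that $[a,[b,c]]=[[a,b],c]+[b,[a,c]]$, $\mathcal L_{\rho a}\langle b,c\rangle=\langle[a,b],c\rangle+\langle b,[a,c]\rangle$ and $2[a,a]=\rho^*d\langle a,a\rangle$ (with $E^*\cong E$ via the pairing). Let $\mathcal G$ be a generalized metric, i.e. a smooth self-adjoint endomorphism of $E$ with $\mathcal G^2=1$; put $V_\pm=\ker(\mathcal G\mp1)$ and $a_\pm=\frac12(1\pm\mathcal G)a$. Let $\operatorname{div}:\Gamma(E)\to C^\infty(M)$ be a divergence operator, i.e. $\mathbb R$-linear with $\operatorname{div}(fa)=f\operatorname{div}a+\mathcal L_{\rho a}f$. A generalized connection is an $\mathbb R$-linear map $D:\Gamma(E)\to\Gamma(E^*\otimes E)$, $D_ba:=(Da)b$, with $D(fa)=f\,Da+\rho^*df\otimes a$ and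 $\rho^*d\langle a,b\rangle=\langle Da,b\rangle+\langle a,Db\rangle$. Call $D$ *adapted* to $(\mathcal G,\operatorname{div})$ if it is metric ($D_a\Gamma(V_\pm)\subseteq\Gamma(V_\pm)$ for all $a$), has divergence $\operatorname{div}$ ($\operatorname{div}a=\operatorname{tr}(Da)$), and its torsion $T(a,b)=D_ab-D_ba-[a,b]+(Da)^*b$ is of pure type ($T\in\Gamma(\wedge^3V_+\oplus\wedge^3V_-)$). Put $\mathcal R_0(a,b)c=D_aD_bc-D_bD_ac-D_{[a,b]}c$, and for adapted $D$ let $$\mathrm{Ric}^\pm_{\mathrm{GF}}(a_\mp,b_\pm)=\operatorname{tr}_{V_\pm}\big(\mathcal R_0(\cdot,a_\mp)b_\pm\big),\qquad \mathrm{Ric}(a,b)=\operatorname{tr}\big(\mathcal R(\cdot,a)b\big),$$ where $\mathcal R(a,b)=\mathcal R_0(a_+,b_-)+\mathcal R_0(a_-,b_+)$. **Theorem.** 1. If $\operatorname{rk}V_+\neq1$ and $\operatorname{rk}V_-\neq1$ at every point of $M$, then a generalized connection adapted to $(\mathcal G,\operatorname{div})$ exists. 2. All connections adapted to $(\mathcal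 G,\operatorname{div})$ have the same $\mathrm{Ric}^\pm_{\mathrm{GF}}$ and the same $\mathrm{Ric}$, so these are tensors of the pair $(\mathcal G,\operatorname{div})$ (whenever an adapted connection exists). 3. For every adapted connection, $\mathrm{Ric}(a,b)=\mathrm{Ric}^+_{\mathrm{GF}}(a_-,b_+)+\mathrm{Ric}^-_{\mathrm{GF}}(a_+,b_-)$ for all $a,b\in\Gamma(E)$, and $\mathrm{Ric}$ is symmetric if and only if the pair $(\mathcal G,\operatorname{div})$ is compatible, i.e. $$\operatorname{div}([a_\mp,b_\pm])-\mathcal L_{\rho a_\mp}(\operatorname{div}b_\pm)+\mathcal L_{\rho b_\pm}(\operatorname{div}a_\mp)=0\qquad\text{for all }a_\mp\in\Gamma(V_\mp),\ b_\pm\in\Gamma(V_\pm).$$ -/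

import Mathlib

open Bundle Module
open scoped Manifold ContDiff

noncomputable section

namespace CourantRicci

section

variable {n : ℕ} {M : Type*} [TopologicalSpace M] [ChartedSpace (EuclideanSpace ℝ (Fin n)) M]
  [IsManifold (𝓡 n) ∞ M]
  {F : Type*} [NormedAddCommGroup F] [NormedSpace ℝ F]
  {E : M → Type*} [TopologicalSpace (TotalSpace F E)]
  [∀ x, AddCommGroup (E x)] [∀ x, Module ℝ (E x)] [∀ x, TopologicalSpace (E x)]
  [∀ x, IsTopologicalAddGroup (E x)] [∀ x, ContinuousSMul ℝ (E x)]
  [FiberBundle F E] [VectorBundle ℝ F E] [ContMDiffVectorBundle ∞ F E (𝓡 n)]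

/-- `Γ(E)`: the real vector space of smooth sections of the vector bundle `E → M`. -/
abbrev Sec (n : ℕ) {M : Type*} [TopologicalSpace M]
    [ChartedSpace (EuclideanSpace ℝ (Fin n)) M]
    (F : Type*) [NormedAddCommGroup F] [NormedSpace ℝ F]
    (E : M → Type*) [TopologicalSpace (TotalSpace F E)]
    [∀ x, TopologicalSpace (E x)] [FiberBundle F E] :=
  ContMDiffSection (𝓡 n) F ∞ E

/-- `Γ(End E) = Γ(E^* ⊗ E)`: smooth sections of the bundle of fibrewise endomorphisms. -/
abbrev EndSec (n : ℕ) {M : Type*} [TopologicalSpace M]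
    [ChartedSpace (EuclideanSpace ℝ (Fin n)) M]
    (F : Type*) [NormedAddCommGroup F] [NormedSpace ℝ F]
    (E : M → Type*) [TopologicalSpace (TotalSpace F E)]
    [∀ x, AddCommGroup (E x)] [∀ x, Module ℝ (E x)] [∀ x, TopologicalSpace (E x)]
    [∀ x, IsTopologicalAddGroup (E x)] [∀ x, ContinuousSMul ℝ (E x)]
    [FiberBundle F E] [VectorBundle ℝ F E] :=
  ContMDiffSection (𝓡 n) (F →L[ℝ] F) ∞ (fun x : M => E x →L[ℝ] E x)

/-- The section `f a`, for a smooth function `f` and a smooth section `a`. -/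
def fsmul (f : C^∞⟮𝓡 n, M; ℝ⟯) (a : Sec n F E) : Sec n F E :=
  ⟨fun x => f x • a x, f.contMDiff.smul_section a.contMDiff⟩

/-- The section `A a`, for a smooth field of endomorphisms `A` and a smooth section `a`. -/
def EndSec.app (A : EndSec n F E) (a : Sec n F E) : Sec n F E :=
  ⟨fun x => A x (a x), ContMDiff.clm_bundle_apply A.contMDiff a.contMDiff⟩

variable (n F E) in
/-- A Courant algebroid structure on the smooth real vector bundle `E → M`. -/
structure CourantAlgebroid where
  /-- the pairing `⟨·,·⟩`, a smooth field of bilinear forms -/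
  pairing : ContMDiffSection (𝓡 n) (F →L[ℝ] F →L[ℝ] ℝ) ∞
    (fun x : M => E x →L[ℝ] E x →L[ℝ] ℝ)
  pairing_symm : ∀ x (v w : E x), pairing x v w = pairing x w v
  pairing_nondeg : ∀ x (v : E x), (∀ w : E x, pairing x v w = 0) → v = 0
  /-- the anchor `ρ : E → TM`, a morphism of vector bundles -/
  anchor : ContMDiffSection (𝓡 n) (F →L[ℝ] EuclideanSpace ℝ (Fin n)) ∞
    (fun x : M => E x →L[ℝ] TangentSpace (𝓡 n) x)
  /-- the bracket on sections, bilinear over the real numbers -/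
  bracket : Sec n F E →ₗ[ℝ] Sec n F E →ₗ[ℝ] Sec n F E
  jacobi : ∀ a b c, bracket a (bracket b c) = bracket (bracket a b) c + bracket b (bracket a c)
  invariance : ∀ (a b c : Sec n F E) (x : M),
    mvfderiv (𝓡 n) (fun y => pairing y (b y) (c y)) x (anchor x (a x)) =
      pairing x (bracket a b x) (c x) + pairing x (b x) (bracket a c x)
  /-- `2 [a, a] = ρ^* d⟨a, a⟩`, paired with an arbitrary vector -/
  two_bracket_self : ∀ (a : Sec n F E) (x : M) (v : E x),
    2 * pairing x (bracket a a x) v =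
      mvfderiv (𝓡 n) (fun y => pairing y (a y) (a y)) x (anchor x v)

namespace CourantAlgebroid

variable (C : CourantAlgebroid n F E)

/-- The derivative `df (ρ v)` of a function in the direction of the anchor of `v`, so that
`C.lie f x (a x)` is the value at `x` of the Lie derivative of `f` along `ρ a`, and
`C.lie f x` is `ρ^* df` as a covector on `E x`. -/
def lie (f : M → ℝ) (x : M) (v : E x) : ℝ := mvfderiv (𝓡 n) f x (C.anchor x v)

/-- A generalized connection: `D a` is a section of `E^* ⊗ E`, with `(D_b a)(x) = D a x (b x)`. -/
structure Connection where
  toLin : Sec n F E →ₗ[ℝ] EndSec n F E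
  leibniz : ∀ (f : C^∞⟮𝓡 n, M; ℝ⟯) (a : Sec n F E) (x : M) (v : E x),
    toLin (fsmul f a) x v = f x • toLin a x v + C.lie f x v • a x
  pairing_parallel : ∀ (a b : Sec n F E) (x : M) (v : E x),
    C.lie (fun y => C.pairing y (a y) (b y)) x v =
      C.pairing x (toLin a x v) (b x) + C.pairing x (a x) (toLin b x v)

/-- A divergence operator. -/
structure Divergence where
  toLin : Sec n F E →ₗ[ℝ] C^∞⟮𝓡 n, M; ℝ⟯
  leibniz : ∀ (f : C^∞⟮𝓡 n, M; ℝ⟯) (a : Sec n F E) (x : M),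
    toLin (fsmul f a) x = f x * toLin a x + C.lie f x (a x)

/-- A generalized metric, as a self-adjoint smooth field of involutions of `E`; its eigenbundles
for `1` and `-1` are `V₊` and `V₋`. -/
structure GeneralizedMetric where
  G : EndSec n F E
  involutive : ∀ x (v : E x), G x (G x v) = v
  selfAdjoint : ∀ x (v w : E x), C.pairing x (G x v) w = C.pairing x v (G x w)

namespace GeneralizedMetric

variable {C} (G : C.GeneralizedMetric)

/-- The fibre at `x` of the eigenbundle `V₊` (for `s = 1`) or `V₋` (for `s = -1`). -/
def V (s : ℤˣ) (x : M) : Submodule ℝ (E x) :=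
  LinearMap.ker ((G.G x : E x →ₗ[ℝ] E x) - ((s : ℤ) : ℝ) • LinearMap.id)

/-- `a` is a section of `V₊` (for `s = 1`) or of `V₋` (for `s = -1`). -/
def IsSec (s : ℤˣ) (a : Sec n F E) : Prop := ∀ x, a x ∈ G.V s x

/-- The projections `a₊ = (a + G a) / 2` (for `s = 1`) and `a₋ = (a - G a) / 2` (for `s = -1`). -/
def proj (s : ℤˣ) (a : Sec n F E) : Sec n F E :=
  (1 / 2 : ℝ) • (a + ((s : ℤ) : ℝ) • G.G.app a)

end GeneralizedMetric

variable {C}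

/-- The trace, at the point `x`, of a tensorial operator `T` on the sections of a subbundle `W`
of `E`: the trace of the endomorphism `A` of the fibre `W x` that `T` induces, i.e. the one with
`A (e x) = (T e) x` for every section `e` of `W`. (Such an `A` is unique, as every vector of `W x`
extends to a section of `W`; the value `0` for operators that are not tensorial is never used.) -/
def fiberTrace (W : ∀ x : M, Submodule ℝ (E x)) (T : Sec n F E → Sec n F E) (x : M) : ℝ :=
  open scoped Classical in
  if h : ∃ A : W x →ₗ[ℝ] W x, ∀ (e : Sec n F E) (he : ∀ y, e y ∈ W y),
      (A ⟨e x, he x⟩ : E x) = T e x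
  then LinearMap.trace ℝ (W x) h.choose else 0

namespace Connection

variable (D : C.Connection)

/-- `D.nabla b a` is the section `D_b a`. -/
def nabla (b a : Sec n F E) : Sec n F E := (D.toLin a).app b

/-- The naive curvature `R₀(a,b)c = D_a D_b c - D_b D_a c - D_{[a,b]} c`. -/
def R₀ (a b c : Sec n F E) : Sec n F E :=
  D.nabla a (D.nabla b c) - D.nabla b (D.nabla a c) - D.nabla (C.bracket a b) c

/-- The torsion `⟨T(a,b), c⟩`, where `T(a,b) = D_a b - D_b a - [a,b] + (D a)^* b`. -/
def torsion (a b c : Sec n F E) (x : M) : ℝ :=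
  C.pairing x ((D.nabla a b - D.nabla b a - C.bracket a b) x) (c x) +
    C.pairing x (b x) (D.nabla c a x)

/-- `D` is a metric connection: it preserves `V₊` and `V₋`. -/
def IsMetric (G : C.GeneralizedMetric) : Prop :=
  ∀ (s : ℤˣ) (a b : Sec n F E), G.IsSec s b → G.IsSec s (D.nabla a b)

/-- The torsion of `D` is of pure type: it lies in `Λ³ V₊ ⊕ Λ³ V₋`. -/
def IsPureType (G : C.GeneralizedMetric) : Prop :=
  ∀ (a b c : Sec n F E) (x : M), D.torsion a b c x =
    D.torsion (G.proj 1 a) (G.proj 1 b) (G.proj 1 c) x +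
      D.torsion (G.proj (-1) a) (G.proj (-1) b) (G.proj (-1) c) x

/-- `δ` is the divergence of `D`: `δ a = tr (D a)`. -/
def HasDivergence (δ : C.Divergence) : Prop :=
  ∀ (a : Sec n F E) (x : M),
    δ.toLin a x = LinearMap.trace ℝ (E x) (D.toLin a x : E x →ₗ[ℝ] E x)

/-- The connections that compute the generalized Ricci curvature of the pair `(G, δ)`: metric,
with pure-type torsion and divergence `δ`. -/
structure IsAdapted (G : C.GeneralizedMetric) (δ : C.Divergence) : Prop where
  isMetric : D.IsMetric G
  isPureType : D.IsPureType G
  hasDivergence : D.HasDivergence δ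

/-- The generalized Ricci curvature `Ric⁺` (for `s = 1`) or `Ric⁻` (for `s = -1`) of a metric
connection, `Ric^±(a_∓, b_±) = tr_± (R₀(·, a_∓) b_±)`, evaluated on the components
`a_∓`, `b_±` of arbitrary sections `a`, `b`. -/
def ricciGF (G : C.GeneralizedMetric) (s : ℤˣ) (a b : Sec n F E) : M → ℝ :=
  fiberTrace (G.V s) (fun e => D.R₀ e (G.proj (-s) a) (G.proj s b))

/-- The total curvature `R(a,b) = R₀(a₊, b₋) + R₀(a₋, b₊)`. -/
def totalCurvature (G : C.GeneralizedMetric) (a b c : Sec n F E) : Sec n F E :=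
  D.R₀ (G.proj 1 a) (G.proj (-1) b) c + D.R₀ (G.proj (-1) a) (G.proj 1 b) c

/-- The total generalized Ricci curvature `Ric(a,b) = tr (R(·, a) b)`. -/
def ricci (G : C.GeneralizedMetric) (a b : Sec n F E) : M → ℝ :=
  fiberTrace (fun _ => ⊤) (fun e => D.totalCurvature G e a b)

end Connection

/-- Compatibility of the pair `(G, δ)`:
`δ [a_∓, b_±] - L_{ρ a_∓} (δ b_±) + L_{ρ b_±} (δ a_∓) = 0`. -/
def IsCompatible (G : C.GeneralizedMetric) (δ : C.Divergence) : Prop :=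
  ∀ (s : ℤˣ) (a b : Sec n F E), G.IsSec (-s) a → G.IsSec s b → ∀ x : M,
    δ.toLin (C.bracket a b) x - C.lie (δ.toLin b) x (a x) + C.lie (δ.toLin a) x (b x) = 0

end CourantAlgebroid

end

end CourantRicci

end

/-! ### Evaluation of sections; smoothness of pairings and rank-one endomorphism fields. -/

noncomputable section

namespace CourantRicci

set_option linter.unusedSectionVars false

variable {n : ℕ} {M : Type*} [TopologicalSpace M] [ChartedSpace (EuclideanSpace ℝ (Fin n)) M]
  [IsManifold (𝓡 n) ∞ M]
  {F : Type*} [NormedAddCommGroup F] [NormedSpace ℝ F]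
  {E : M → Type*} [TopologicalSpace (TotalSpace F E)]
  [∀ x, AddCommGroup (E x)] [∀ x, Module ℝ (E x)] [∀ x, TopologicalSpace (E x)]
  [∀ x, IsTopologicalAddGroup (E x)] [∀ x, ContinuousSMul ℝ (E x)]
  [FiberBundle F E] [VectorBundle ℝ F E] [ContMDiffVectorBundle ∞ F E (𝓡 n)]

/-! Uniqueness. For an adapted connection the mixed derivatives are forced: paired with mixed
arguments, pure-type torsion leaves only `D_a b = [a,b]_±` for `a` in `V_∓`, `b` in `V_±`
(`nabla_eq_proj_bracket`). Expand the trace over `V_±` of `R₀(e,a)b` with this rule. The term `D_e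
D_a b` contributes `div([a,b]_±)`. The term `D_a D_e b`, together with the `V_±`-part of `D_{[e,a]}
b`, is the derivative along `a` of the trace of `D b`, hence contributes `-L_a(div b)`. The
`V_∓`-part of `[e,a]` again gives a bracket, and with it an expression `bracketTrace` free of `D`
(`IsAdapted.sum_R₀`). So the curvature depends only on the metric and the divergence.

Symmetry. Invariance of the pairing makes `bracketTrace` symmetric under exchange of `a`, `b` and of
`V_±` (`bracketTrace_symm`). It therefore cancels in `Ric^±(a,b) - Ric^∓(b,a)`, and what remains is
exactly the compatibility expression (`IsAdapted.ricciGF_sub`). Since `Ric` is the sum of its two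
halves, which see complementary pairs of components, symmetry is compatibility.

Existence. Generalized connections exist by a partition of unity (`Divergence.nonempty_connection`).
Projecting one to `V_±` and replacing its mixed derivatives by brackets gives a metric connection
with pure-type torsion (`Connection.exists_isHalfConnection`, `IsMetric.isPureType`). The trace on
`V_±`, of rank `r`, is then corrected by a term `(φ(a) v - ⟨v,a⟩ u) / (r - 1)` with `u` dual to the
defect `φ`; this is where `r ≠ 1` is needed (`IsHalfConnection.exists_trace_eq`).

All traces are computed with pairs of globally defined sections that are dual near a point
(`DualFrame`). -/

@[simp]
theorem fsmul_apply (f : C^∞⟮𝓡 n, M; ℝ⟯) (a : Sec n F E) (x : M) : fsmul f a x = f x • a x := rfl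

@[simp]
theorem EndSec.app_apply (A : EndSec n F E) (a : Sec n F E) (x : M) : A.app a x = A x (a x) := rfl

@[simp]
theorem Sec.add_apply (a b : Sec n F E) (x : M) : (a + b) x = a x + b x := rfl

@[simp]
theorem Sec.sub_apply (a b : Sec n F E) (x : M) : (a - b) x = a x - b x := rfl

@[simp]
theorem Sec.neg_apply (a : Sec n F E) (x : M) : (-a) x = -a x := rfl

@[simp]
theorem Sec.zero_apply (x : M) : (0 : Sec n F E) x = 0 := rfl

@[simp]
theorem Sec.smul_apply (r : ℝ) (a : Sec n F E) (x : M) : (r • a) x = r • a x := rfl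

@[simp]
theorem Sec.sum_apply {ι : Type*} (t : Finset ι) (a : ι → Sec n F E) (x : M) :
    (∑ i ∈ t, a i) x = ∑ i ∈ t, a i x := by
  classical
  induction t using Finset.induction_on with
  | empty => simp
  | insert i t hi h => simp [Finset.sum_insert hi, h]

theorem contMDiffAt_smulRight {φ : ∀ x : M, E x →L[ℝ] ℝ} {s : ∀ x : M, E x} {x : M}
    (hφ : ContMDiffAt (𝓡 n) ((𝓡 n).prod 𝓘(ℝ, F →L[ℝ] ℝ)) ∞
      (fun y => TotalSpace.mk' (F →L[ℝ] ℝ) (E := fun y : M => E y →L[ℝ] ℝ) y (φ y)) x)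
    (hs : ContMDiffAt (𝓡 n) ((𝓡 n).prod 𝓘(ℝ, F)) ∞ (fun y => TotalSpace.mk' F y (s y)) x) :
    ContMDiffAt (𝓡 n) ((𝓡 n).prod 𝓘(ℝ, F →L[ℝ] F)) ∞
      (fun y => TotalSpace.mk' (F →L[ℝ] F) (E := fun y : M => E y →L[ℝ] E y) y
        ((φ y).smulRight (s y))) x := by
  have hφ' := ((contMDiffAt_hom_bundle (E₂ := Bundle.Trivial M ℝ) _).1 hφ).2
  have hs' := (contMDiffAt_section x).1 hs
  refine (contMDiffAt_hom_bundle _).2 ⟨contMDiffAt_id, ?_⟩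
  -- In the trivialization at `x` the field is a fixed bilinear map applied to the coordinates of
  -- `φ` and `s`.
  have key : ContMDiffAt (𝓡 n) 𝓘(ℝ, F →L[ℝ] F) ∞ (fun y =>
      ContinuousLinearMap.smulRightL ℝ F F
        (ContinuousLinearMap.inCoordinates F E ℝ (Bundle.Trivial M ℝ) x y x y (φ y))
        ((trivializationAt F E x (TotalSpace.mk' F y (s y))).2)) x :=
    (contMDiffAt_const.clm_apply hφ').clm_apply hs'
  refine key.congr_of_eventuallyEq ?_
  filter_upwards [(trivializationAt F E x).open_baseSet.mem_nhds
    (mem_baseSet_trivializationAt F E x)] with y hy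
  ext v
  simp [ContinuousLinearMap.inCoordinates, hy, Trivialization.coe_linearMapAt_of_mem]

namespace CourantAlgebroid

variable (C : CourantAlgebroid n F E)

/-- The pairing of two sections, as a smooth function. -/
def pair (a b : Sec n F E) : C^∞⟮𝓡 n, M; ℝ⟯ :=
  ⟨fun x => C.pairing x (a x) (b x), fun x => (contMDiffAt_section x).1
    (ContMDiff.clm_bundle_apply₂ (F₃ := ℝ) (E₃ := Bundle.Trivial M ℝ)
      C.pairing.contMDiff a.contMDiff b.contMDiff x)⟩

@[simp]
theorem pair_apply (a b : Sec n F E) (x : M) : C.pair a b x = C.pairing x (a x) (b x) := rfl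

/-- The endomorphism field `v ↦ ⟨a, v⟩ b`. -/
def rankOne (a b : Sec n F E) : EndSec n F E :=
  ⟨fun x => (C.pairing x (a x)).smulRight (b x), fun x => contMDiffAt_smulRight
    (ContMDiff.clm_bundle_apply C.pairing.contMDiff a.contMDiff x) (b.contMDiff x)⟩

@[simp]
theorem rankOne_apply (a b : Sec n F E) (x : M) (v : E x) :
    C.rankOne a b x v = C.pairing x (a x) v • b x := rfl

end CourantAlgebroid

/-! ### Local dual frames for the pairing. -/

namespace CourantAlgebroid

variable (C : CourantAlgebroid n F E)

/-- A pair of families of sections `e i`, `w i` that are dual to each other near `x` in the image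
of the fibrewise projection `P`, normalised by a cutoff function `χ`. -/
structure DualFrame (P : ∀ y : M, E y →ₗ[ℝ] E y) (x : M) where
  e : Fin (finrank ℝ F) → Sec n F E
  w : Fin (finrank ℝ F) → Sec n F E
  χ : C^∞⟮𝓡 n, M; ℝ⟯
  eventually_one : ∀ᶠ y in nhds x, χ y = 1
  map_e : ∀ i y, P y (e i y) = e i y
  map_w : ∀ i y, P y (w i y) = w i y
  sum_eq : ∀ y v, ∑ i, C.pairing y (w i y) v • e i y = χ y • P y v

variable [T2Space M] [FiniteDimensional ℝ F]

/-- A local frame is multiplied by a bump function supported in the trivialization domain; where the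
bump is nonzero this only rescales a basis. -/
theorem exists_sections_basis (x : M) : ∃ (e : Fin (finrank ℝ F) → Sec n F E) (U : Set M),
    U ∈ nhds x ∧ ∀ y ∈ U, ∃ b : Basis (Fin (finrank ℝ F)) ℝ (E y), ∀ i, b i = e i y := by
  let t := trivializationAt F E x
  let b := finBasis ℝ F
  obtain ⟨f, -, hf⟩ := (SmoothBumpFunction.nhds_basis_tsupport (I := 𝓡 n) x).mem_iff.1
    (t.open_baseSet.mem_nhds (mem_baseSet_trivializationAt F E x))
  refine ⟨fun i => ⟨fun y => f y • t.localFrame b i y,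
    ContMDiffOn.smul_section_of_tsupport f.contMDiff.contMDiffOn t.open_baseSet hf
      (t.contMDiffOn_localFrame_baseSet ∞ b i)⟩, Function.support f, f.support_mem_nhds,
    fun y hy => ?_⟩
  have hyt : y ∈ t.baseSet := hf (subset_closure hy)
  refine ⟨(t.basisAt b hyt).unitsSMul (fun _ => Units.mk0 (f y) hy), fun i => ?_⟩
  simp only [Basis.unitsSMul_apply, Units.smul_def]
  simp [hyt]
  rfl

/-- This is `adj(g) g = det g` for the Gram matrix `g`. The adjugate replaces the inverse because
its entries stay smooth where `g` degenerates. -/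
theorem gram_sum {V ι : Type*} [AddCommGroup V] [Module ℝ V] [Fintype ι] [DecidableEq ι]
    (B : V →ₗ[ℝ] V →ₗ[ℝ] ℝ) (b : Basis ι ℝ V) (v : V) :
    ∑ i, B (∑ j, (Matrix.of fun i j => B (b i) (b j)).adjugate i j • b j) v • b i =
      (Matrix.of fun i j => B (b i) (b j)).det • v := by
  set g : Matrix ι ι ℝ := Matrix.of fun i j => B (b i) (b j) with hg
  have h : (∑ i, ((∑ j, g.adjugate i j • B (b j)).smulRight (b i))) = g.det • LinearMap.id := by
    refine b.ext fun k => ?_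
    have : ∀ i, ∑ j, g.adjugate i j * B (b j) (b k) = (g.det • (1 : Matrix ι ι ℝ)) i k := by
      intro i
      rw [← Matrix.adjugate_mul, Matrix.mul_apply]
      simp [hg]
    simp [this, Matrix.one_apply]
  simpa using LinearMap.congr_fun h v

theorem gram_det_ne_zero {V ι : Type*} [AddCommGroup V] [Module ℝ V] [Fintype ι] [DecidableEq ι]
    (B : V →ₗ[ℝ] V →ₗ[ℝ] ℝ) (hB : ∀ v, (∀ w, B w v = 0) → v = 0) (b : Basis ι ℝ V) :
    (Matrix.of fun i j => B (b i) (b j)).det ≠ 0 := by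
  intro h
  obtain ⟨c, hc, h0⟩ := Matrix.exists_mulVec_eq_zero_iff.2 h
  refine hc (funext fun i => ?_)
  have : ∑ j, c j • b j = 0 := by
    refine hB _ fun w => ?_
    have h' : B.flip (∑ j, c j • b j) = 0 := b.ext fun k => by
      simpa [Matrix.mulVec, dotProduct, mul_comm] using congrFun h0 k
    simpa using LinearMap.congr_fun h' w
  exact (Fintype.linearIndependent_iff.1 b.linearIndependent) c this i

/-- The pairing at a point, as a bilinear form. -/
def form (x : M) : E x →ₗ[ℝ] E x →ₗ[ℝ] ℝ :=
  LinearMap.mk₂ ℝ (fun v w => C.pairing x v w) (by simp) (by simp) (by simp) (by simp)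

@[simp]
theorem form_apply (x : M) (v w : E x) : C.form x v w = C.pairing x v w := rfl

theorem exists_dualFrame (x : M) : Nonempty (C.DualFrame (fun _ => LinearMap.id) x) := by
  obtain ⟨e, U, hU, he⟩ := exists_sections_basis (n := n) (F := F) (E := E) x
  let g : Matrix (Fin (finrank ℝ F)) (Fin (finrank ℝ F)) C^∞⟮𝓡 n, M; ℝ⟯ :=
    Matrix.of fun i j => C.pair (e i) (e j)
  let ev (y : M) : C^∞⟮𝓡 n, M; ℝ⟯ →+* ℝ := ContMDiffMap.evalRingHom y
  have hg : ∀ y, (ev y).mapMatrix g = Matrix.of fun i j => C.form y (e i y) (e j y) :=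
    fun y => rfl
  have hdet : ∀ y, g.det y = (Matrix.of fun i j => C.form y (e i y) (e j y)).det := fun y => by
    rw [← hg, ← RingHom.map_det]; rfl
  have hadj : ∀ y i j, g.adjugate i j y =
      (Matrix.of fun i j => C.form y (e i y) (e j y)).adjugate i j := fun y i j => by
    rw [← hg, ← RingHom.map_adjugate]; rfl
  have hUdet : ∀ y ∈ U, g.det y ≠ 0 := by
    intro y hy
    obtain ⟨b, hb⟩ := he y hy
    rw [hdet]
    simp only [← hb]
    refine gram_det_ne_zero _ (fun v hv => C.pairing_nondeg y v fun w => ?_) b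
    rw [C.pairing_symm]
    exact hv w
  obtain ⟨ψ, -, hψ⟩ := (SmoothBumpFunction.nhds_basis_tsupport (I := 𝓡 n) x).mem_iff.1 hU
  -- Division by the determinant is harmless: `ψ` is supported in `U`, where the sections form a
  -- basis and the determinant does not vanish.
  let φ : C^∞⟮𝓡 n, M; ℝ⟯ := ⟨fun y => ψ y * (g.det y)⁻¹, contMDiff_of_tsupport fun y hy =>
    ψ.contMDiffAt.mul ((g.det).contMDiff y |>.inv₀
      (hUdet y (hψ (closure_mono (fun z hz => left_ne_zero_of_mul hz) hy))))⟩
  have hφ : ∀ y, φ y = ψ y * (g.det y)⁻¹ := fun y => rfl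
  refine ⟨⟨e, fun i => fsmul φ (∑ j, fsmul (g.adjugate i j) (e j)), φ * g.det, ?_,
    fun _ _ => rfl, fun _ _ => rfl, fun y v => ?_⟩⟩
  · filter_upwards [ψ.eventuallyEq_one, hU] with y h1 hy
    have : g.det y ≠ 0 := hUdet y hy
    change φ y * g.det y = 1
    rw [hφ, h1]
    simp [this]
  · change _ = (φ y * g.det y) • v
    by_cases hy : ψ y = 0
    · simp [hφ, hy]
    · obtain ⟨b, hb⟩ := he y (hψ (subset_closure hy))
      have := gram_sum (C.form y) b v
      simp only [hb, ← hdet, ← hadj] at this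
      rw [mul_smul, ← this, Finset.smul_sum]
      simp [mul_smul]

end CourantAlgebroid

/-! ### Eigenbundle projections, and derivatives along the anchor. -/

namespace CourantAlgebroid

variable {C : CourantAlgebroid n F E}

namespace GeneralizedMetric

variable (G : C.GeneralizedMetric)

/-- The projection onto `V₊` (for `s = 1`) or `V₋` (for `s = -1`) in the fibre at `x`. -/
def P (s : ℤˣ) (x : M) : E x →ₗ[ℝ] E x :=
  (1 / 2 : ℝ) • (LinearMap.id + ((s : ℤ) : ℝ) • (G.G x : E x →ₗ[ℝ] E x))

theorem P_apply (s : ℤˣ) (x : M) (v : E x) :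
    G.P s x v = (1 / 2 : ℝ) • (v + ((s : ℤ) : ℝ) • G.G x v) := rfl

@[simp]
theorem proj_apply (s : ℤˣ) (a : Sec n F E) (x : M) : G.proj s a x = G.P s x (a x) := rfl

theorem unit_mul_self (s : ℤˣ) : ((s : ℤ) : ℝ) * ((s : ℤ) : ℝ) = 1 := by
  rcases Int.units_eq_one_or s with rfl | rfl <;> simp

theorem mem_V_iff {s : ℤˣ} {x : M} {v : E x} : v ∈ G.V s x ↔ G.P s x v = v := by
  have hs := unit_mul_self s
  have h1 : v ∈ G.V s x ↔ G.G x v = ((s : ℤ) : ℝ) • v := by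
    simp [V, LinearMap.mem_ker, sub_eq_zero]
  rw [h1, P_apply]
  constructor
  · intro h
    rw [h, smul_smul, hs]
    module
  · intro h
    have : ((s : ℤ) : ℝ) • G.G x v = v := by
      have h2 := congrArg ((2 : ℝ) • ·) h
      simp only [smul_smul] at h2
      norm_num [two_smul] at h2
      exact h2
    conv_rhs => rw [← this]
    rw [smul_smul, hs, one_smul]

@[simp]
theorem P_P (s : ℤˣ) (x : M) (v : E x) : G.P s x (G.P s x v) = G.P s x v := by
  rcases Int.units_eq_one_or s with rfl | rfl <;>
  · simp [P_apply, G.involutive]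
    module

@[simp]
theorem P_neg_P (s : ℤˣ) (x : M) (v : E x) : G.P (-s) x (G.P s x v) = 0 := by
  rcases Int.units_eq_one_or s with rfl | rfl <;>
  · simp [P_apply, G.involutive]
    try module

@[simp]
theorem P_P_neg (s : ℤˣ) (x : M) (v : E x) : G.P s x (G.P (-s) x v) = 0 := by
  simpa using G.P_neg_P (-s) x v

theorem P_add_P_neg (s : ℤˣ) (x : M) (v : E x) : G.P s x v + G.P (-s) x v = v := by
  simp only [P_apply, Units.val_neg, Int.cast_neg]
  module

theorem pairing_P (s : ℤˣ) (x : M) (v w : E x) :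
    C.pairing x (G.P s x v) w = C.pairing x v (G.P s x w) := by
  simp [P_apply, G.selfAdjoint]

variable {G}

theorem P_mem (s : ℤˣ) (x : M) (v : E x) : G.P s x v ∈ G.V s x := by
  rw [mem_V_iff]; simp

theorem P_of_mem {s : ℤˣ} {x : M} {v : E x} (h : v ∈ G.V s x) : G.P s x v = v := G.mem_V_iff.1 h

theorem P_neg_of_mem {s : ℤˣ} {x : M} {v : E x} (h : v ∈ G.V s x) : G.P (-s) x v = 0 := by
  rw [← P_of_mem h]; simp

theorem P_of_mem_neg {s : ℤˣ} {x : M} {v : E x} (h : v ∈ G.V (-s) x) : G.P s x v = 0 := by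
  rw [← P_of_mem h]; simp

theorem pairing_eq_zero {s : ℤˣ} {x : M} {v w : E x} (hv : v ∈ G.V s x) (hw : w ∈ G.V (-s) x) :
    C.pairing x v w = 0 := by
  rw [← P_of_mem hv, pairing_P, P_of_mem_neg hw, map_zero]

theorem pairing_eq_zero' {s : ℤˣ} {x : M} {v w : E x} (hv : v ∈ G.V (-s) x) (hw : w ∈ G.V s x) :
    C.pairing x v w = 0 := by
  rw [C.pairing_symm, pairing_eq_zero hw hv]

theorem pairing_P_left {s : ℤˣ} {x : M} {v w : E x} (hw : w ∈ G.V s x) :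
    C.pairing x (G.P s x v) w = C.pairing x v w := by
  rw [pairing_P, P_of_mem hw]

theorem pairing_P_right {s : ℤˣ} {x : M} {v w : E x} (hv : v ∈ G.V s x) :
    C.pairing x v (G.P s x w) = C.pairing x v w := by
  rw [← pairing_P, P_of_mem hv]

theorem isSec_proj (s : ℤˣ) (a : Sec n F E) : G.IsSec s (G.proj s a) := fun x => P_mem s x (a x)

theorem IsSec.proj_eq {s : ℤˣ} {a : Sec n F E} (h : G.IsSec s a) : G.proj s a = a := by
  ext x; exact P_of_mem (h x)

theorem IsSec.proj_neg_eq {s : ℤˣ} {a : Sec n F E} (h : G.IsSec s a) : G.proj (-s) a = 0 := by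
  ext x; exact P_neg_of_mem (h x)

theorem IsSec.proj_of_neg {s : ℤˣ} {a : Sec n F E} (h : G.IsSec (-s) a) : G.proj s a = 0 := by
  ext x; exact P_of_mem_neg (h x)

theorem proj_add_proj_neg (s : ℤˣ) (a : Sec n F E) : G.proj s a + G.proj (-s) a = a := by
  ext x; exact G.P_add_P_neg s x (a x)

theorem IsSec.add {s : ℤˣ} {a b : Sec n F E} (ha : G.IsSec s a) (hb : G.IsSec s b) :
    G.IsSec s (a + b) := fun x => (G.V s x).add_mem (ha x) (hb x)

theorem IsSec.sub {s : ℤˣ} {a b : Sec n F E} (ha : G.IsSec s a) (hb : G.IsSec s b) :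
    G.IsSec s (a - b) := fun x => (G.V s x).sub_mem (ha x) (hb x)

theorem proj_add (s : ℤˣ) (a b : Sec n F E) : G.proj s (a + b) = G.proj s a + G.proj s b := by
  ext x; simp

theorem proj_smul (s : ℤˣ) (r : ℝ) (a : Sec n F E) : G.proj s (r • a) = r • G.proj s a := by
  ext x; simp

theorem proj_fsmul (s : ℤˣ) (f : C^∞⟮𝓡 n, M; ℝ⟯) (a : Sec n F E) :
    G.proj s (fsmul f a) = fsmul f (G.proj s a) := by
  ext x; simp

variable (G) in
theorem exists_dualFrame [T2Space M] [FiniteDimensional ℝ F] (s : ℤˣ) (x : M) :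
    Nonempty (C.DualFrame (G.P s) x) := by
  obtain ⟨f⟩ := C.exists_dualFrame x
  -- A dual frame of `E` projects to one of the eigenbundle since the projection is self-adjoint.
  refine ⟨⟨fun i => G.proj s (f.e i), fun i => G.proj s (f.w i), f.χ, f.eventually_one,
    fun i y => ?_, fun i y => ?_, fun y v => ?_⟩⟩
  · simp
  · simp
  · have := congrArg (G.P s y) (f.sum_eq y (G.P s y v))
    simpa [pairing_P] using this

end GeneralizedMetric

variable (C)

@[simp]
theorem lie_add_right (f : M → ℝ) (x : M) (v w : E x) :
    C.lie f x (v + w) = C.lie f x v + C.lie f x w := by simp [lie]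

@[simp]
theorem lie_smul_right (f : M → ℝ) (x : M) (r : ℝ) (v : E x) :
    C.lie f x (r • v) = r * C.lie f x v := by simp [lie]

theorem mdiffAt (f : C^∞⟮𝓡 n, M; ℝ⟯) (x : M) : MDifferentiableAt (𝓡 n) 𝓘(ℝ, ℝ) f x :=
  f.contMDiff.mdifferentiableAt (by simp)

theorem lie_mul (f g : C^∞⟮𝓡 n, M; ℝ⟯) (x : M) (v : E x) :
    C.lie (f * g : C^∞⟮𝓡 n, M; ℝ⟯) x v = f x * C.lie g x v + g x * C.lie f x v := by
  change mvfderiv (𝓡 n) (⇑f * ⇑g) x (C.anchor x v) = _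
  rw [mvfderiv_mul (mdiffAt f x) (mdiffAt g x)]
  rfl

theorem lie_add (f g : C^∞⟮𝓡 n, M; ℝ⟯) (x : M) (v : E x) :
    C.lie (f + g : C^∞⟮𝓡 n, M; ℝ⟯) x v = C.lie f x v + C.lie g x v := by
  change mvfderiv (𝓡 n) (⇑f + ⇑g) x (C.anchor x v) = _
  rw [mvfderiv_add (mdiffAt f x) (mdiffAt g x)]
  rfl

theorem lie_congr {f g : M → ℝ} {x : M} (h : ∀ᶠ y in nhds x, f y = g y) (v : E x) :
    C.lie f x v = C.lie g x v := by
  have : mfderiv (𝓡 n) 𝓘(ℝ, ℝ) f x = mfderiv (𝓡 n) 𝓘(ℝ, ℝ) g x :=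
    Filter.EventuallyEq.mfderiv_eq h
  simp only [lie, mvfderiv]
  rw [this]
  rfl

theorem lie_const (c : ℝ) (x : M) (v : E x) : C.lie (fun _ => c) x v = 0 := by
  rw [lie, mvfderiv_const]
  rfl

theorem lie_sum {ι : Type*} (t : Finset ι) (f : ι → C^∞⟮𝓡 n, M; ℝ⟯) (x : M) (v : E x) :
    C.lie (∑ i ∈ t, f i : C^∞⟮𝓡 n, M; ℝ⟯) x v = ∑ i ∈ t, C.lie (f i) x v := by
  classical
  induction t using Finset.induction_on with
  | empty => simpa using! C.lie_const 0 x v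
  | insert i t hi h => rw [Finset.sum_insert hi, Finset.sum_insert hi, lie_add, h]

end CourantAlgebroid

/-! ### Bracket identities, traces over dual frames, and tensoriality of mixed curvature. -/

namespace CourantAlgebroid

variable (C : CourantAlgebroid n F E)

theorem invariance_pair (a b c : Sec n F E) (x : M) :
    C.lie (C.pair b c) x (a x) =
      C.pairing x (C.bracket a b x) (c x) + C.pairing x (b x) (C.bracket a c x) :=
  C.invariance a b c x

variable [T2Space M] [FiniteDimensional ℝ F]

theorem finite_fiber {F : Type*} [NormedAddCommGroup F] [NormedSpace ℝ F] {E : M → Type*}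
    [TopologicalSpace (TotalSpace F E)] [∀ x, AddCommGroup (E x)] [∀ x, Module ℝ (E x)]
    [∀ x, TopologicalSpace (E x)] [FiberBundle F E] [VectorBundle ℝ F E] [FiniteDimensional ℝ F]
    (x : M) : Module.Finite ℝ (E x) :=
  Module.Finite.equiv ((trivializationAt F E x).linearEquivAt ℝ x
    (mem_baseSet_trivializationAt F E x)).symm

theorem exists_section_eq (C : CourantAlgebroid n F E) (x : M) (v : E x) : ∃ a : Sec n F E, a x = v := by
  obtain ⟨f⟩ := C.exists_dualFrame x
  refine ⟨∑ i, (C.pairing x (f.w i x) v) • f.e i, ?_⟩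
  simpa [f.eventually_one.self_of_nhds] using f.sum_eq x v

theorem eq_of_pairing_section {x : M} {v w : E x}
    (h : ∀ c : Sec n F E, C.pairing x v (c x) = C.pairing x w (c x)) : v = w := by
  refine sub_eq_zero.1 (C.pairing_nondeg x _ fun u => ?_)
  obtain ⟨c, rfl⟩ := C.exists_section_eq x u
  simp [h]

/-- The Leibniz rule is not an axiom: it follows from invariance applied to `⟨f b, c⟩`, by
nondegeneracy. -/
theorem bracket_fsmul (f : C^∞⟮𝓡 n, M; ℝ⟯) (a b : Sec n F E) (x : M) :
    C.bracket a (fsmul f b) x = f x • C.bracket a b x + C.lie f x (a x) • b x := by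
  refine C.eq_of_pairing_section fun c => ?_
  have h1 := C.invariance_pair a (fsmul f b) c x
  have h2 := C.invariance_pair a b c x
  have h3 : C.pair (fsmul f b) c = f * C.pair b c := by
    ext y; simp
  rw [h3, lie_mul, h2] at h1
  simp at h1 ⊢
  linarith

/-- Polarizing `2[a,a] = ρ^* d⟨a,a⟩` shows that the symmetric part of the bracket is governed by
`d⟨a,b⟩`. -/
theorem bracket_skew {a b : Sec n F E} (h : ∀ y, C.pairing y (a y) (b y) = 0) :
    C.bracket a b = -C.bracket b a := by
  ext x
  refine C.eq_of_pairing_section fun c => ?_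
  have h1 := C.two_bracket_self (a + b) x (c x)
  have h2 := C.two_bracket_self a x (c x)
  have h3 := C.two_bracket_self b x (c x)
  have h4 := C.lie_add (C.pair a a) (C.pair b b) x (c x)
  have h5 : C.pair (a + b) (a + b) = C.pair a a + C.pair b b := by
    ext y
    have : C.pairing y (b y) (a y) = 0 := by rw [C.pairing_symm]; exact h y
    change C.pairing y (a y + b y) (a y + b y) = C.pairing y (a y) (a y) + C.pairing y (b y) (b y)
    simp [h, this]
  rw [← h5] at h4
  change _ = C.lie (C.pair _ _) x (c x) at h1 h2 h3
  rw [h4, ← h2, ← h3] at h1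
  simp at h1 ⊢
  linarith

theorem fsmul_bracket {a b : Sec n F E} (h : ∀ y, C.pairing y (a y) (b y) = 0)
    (f : C^∞⟮𝓡 n, M; ℝ⟯) (x : M) :
    C.bracket (fsmul f a) b x = f x • C.bracket a b x - C.lie f x (b x) • a x := by
  rw [C.bracket_skew (a := fsmul f a) (b := b) (fun y => by simp [h]), C.bracket_skew h]
  simp [bracket_fsmul]
  abel

namespace DualFrame

variable {C} {P : ∀ y : M, E y →ₗ[ℝ] E y} {x : M} (f : C.DualFrame P x)

theorem chi_self : f.χ x = 1 := f.eventually_one.self_of_nhds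

/-- The cutoff is locally constant at `x`, so it disappears from first-order computations there. -/
theorem lie_chi (v : E x) : C.lie f.χ x v = 0 := by
  rw [C.lie_congr f.eventually_one, C.lie_const]

theorem fsmul_chi {c : Sec n F E} (hc : ∀ y, P y (c y) = c y) :
    fsmul f.χ c = ∑ i, fsmul (C.pair (f.w i) c) (f.e i) := by
  ext y
  simp [f.sum_eq, hc]

theorem sum_pairing_comp (y : M) (A : E y →ₗ[ℝ] E y) :
    ∑ i, C.pairing y (f.w i y) (A (f.e i y)) = f.χ y * LinearMap.trace ℝ (E y) (A ∘ₗ P y) := by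
  have := finite_fiber (F := F) (E := E) y
  have h : ∑ i, (C.form y (f.w i y)).smulRight (A (f.e i y)) = f.χ y • (A ∘ₗ P y) := by
    ext v
    simpa using congrArg A (f.sum_eq y v)
  have h' := congrArg (LinearMap.trace ℝ (E y)) h
  rw [map_smul, smul_eq_mul] at h'
  rw [← h', map_sum]
  refine Finset.sum_congr rfl fun i _ => ?_
  rw [LinearMap.trace_smulRight]
  rfl

theorem sum_pairing (y : M) (A : E y →ₗ[ℝ] E y) (hA : ∀ v, P y (A v) = A v) :
    ∑ i, C.pairing y (f.w i y) (A (f.e i y)) = f.χ y * LinearMap.trace ℝ (E y) A := by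
  have := finite_fiber (F := F) (E := E) y
  rw [f.sum_pairing_comp, LinearMap.trace_comp_comm']
  congr 2
  ext v
  exact hA v

end DualFrame

variable {C}

/-- A spanning family of sections both produces the endomorphism sought by `fiberTrace` and forces
its uniqueness, so the arbitrary choice there is immaterial. -/
theorem fiberTrace_eq_sum {ι : Type*} [Fintype ι] (W : ∀ x : M, Submodule ℝ (E x))
    (T : Sec n F E → Sec n F E) (x : M) (e : ι → Sec n F E) (he : ∀ i y, e i y ∈ W y)
    (l : ι → E x →ₗ[ℝ] ℝ) (hl : ∀ v ∈ W x, v = ∑ i, l i v • e i x)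
    (hT : ∀ c : Sec n F E, (∀ y, c y ∈ W y) → T c x = ∑ i, l i (c x) • T (e i) x)
    (hW : ∀ i, T (e i) x ∈ W x) :
    fiberTrace W T x = ∑ i, l i (T (e i) x) := by
  have := finite_fiber (F := F) (E := E) x
  have h : ∃ A : W x →ₗ[ℝ] W x, ∀ (e : Sec n F E) (he : ∀ y, e y ∈ W y),
      (A ⟨e x, he x⟩ : E x) = T e x := by
    refine ⟨∑ i, ((l i) ∘ₗ (W x).subtype).smulRight ⟨T (e i) x, hW i⟩, fun c hc => ?_⟩
    rw [hT c hc]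
    simp
  rw [fiberTrace, dif_pos h]
  have hA : h.choose = ∑ i, ((l i) ∘ₗ (W x).subtype).smulRight ⟨T (e i) x, hW i⟩ := by
    refine LinearMap.ext fun v => ?_
    have hv : v = ∑ i, l i v • (⟨e i x, he i x⟩ : W x) := by
      ext; simpa using hl v v.2
    have hi : ∀ i, h.choose ⟨e i x, he i x⟩ = ⟨T (e i) x, hW i⟩ := fun i =>
      Subtype.ext (h.choose_spec (e i) (he i))
    conv_lhs => rw [hv]
    simp only [map_sum, map_smul, hi]
    ext
    simp
  rw [hA, map_sum]
  refine Finset.sum_congr rfl fun i _ => ?_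
  rw [LinearMap.trace_smulRight]
  rfl

namespace Connection

variable (D : C.Connection)

@[simp]
theorem nabla_apply (b a : Sec n F E) (x : M) : D.nabla b a x = D.toLin a x (b x) := rfl

theorem nabla_fsmul (f : C^∞⟮𝓡 n, M; ℝ⟯) (a b : Sec n F E) :
    D.nabla (fsmul f b) a = fsmul f (D.nabla b a) := by
  ext x; simp

theorem nabla_add (a b c : Sec n F E) : D.nabla (a + b) c = D.nabla a c + D.nabla b c := by
  ext x; simp

theorem R₀_add (a b c d : Sec n F E) : D.R₀ (a + b) c d = D.R₀ a c d + D.R₀ b c d := by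
  ext x
  simp [R₀, nabla_add]
  abel

theorem R₀_zero (c d : Sec n F E) : D.R₀ 0 c d = 0 := by
  simpa using D.R₀_add 0 0 c d

theorem R₀_add_right (a b c d : Sec n F E) : D.R₀ a b (c + d) = D.R₀ a b c + D.R₀ a b d := by
  have h : ∀ u v w : Sec n F E, D.nabla u (v + w) = D.nabla u v + D.nabla u w := fun u v w => by
    ext x; simp
  simp only [R₀, h]
  abel

theorem R₀_sum {ι : Type*} (t : Finset ι) (e : ι → Sec n F E) (a b : Sec n F E) :
    D.R₀ (∑ i ∈ t, e i) a b = ∑ i ∈ t, D.R₀ (e i) a b := by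
  classical
  induction t using Finset.induction_on with
  | empty => simpa using D.R₀_zero a b
  | insert i t hi h => rw [Finset.sum_insert hi, Finset.sum_insert hi, R₀_add, h]

/-- In general `[f e, a]` has an anomalous term `⟨e,a⟩ ρ^* df`. Orthogonality removes it, and the
remaining derivatives of `f` cancel as for ordinary curvature. -/
theorem R₀_fsmul {e a : Sec n F E} (h : ∀ y, C.pairing y (e y) (a y) = 0)
    (f : C^∞⟮𝓡 n, M; ℝ⟯) (b : Sec n F E) :
    D.R₀ (fsmul f e) a b = fsmul f (D.R₀ e a b) := by
  ext x
  simp [R₀, nabla_fsmul, D.leibniz, C.fsmul_bracket h]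
  module

variable {D} {G : C.GeneralizedMetric} {s : ℤˣ}

open GeneralizedMetric

theorem R₀_apply_eq_sum {x : M} (f : C.DualFrame (G.P s) x) {c a : Sec n F E}
    (hc : G.IsSec s c) (ha : G.IsSec (-s) a) (b : Sec n F E) :
    D.R₀ c a b x = ∑ i, C.pairing x (f.w i x) (c x) • D.R₀ (f.e i) a b x := by
  have he : ∀ i y, f.e i y ∈ G.V s y := fun i y => G.mem_V_iff.2 (f.map_e i y)
  have h1 := D.R₀_fsmul (e := c) (a := a) (fun y => pairing_eq_zero (hc y) (ha y)) f.χ b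
  rw [f.fsmul_chi (fun y => P_of_mem (hc y)), D.R₀_sum] at h1
  have h2 := DFunLike.congr_fun h1 x
  rw [fsmul_apply, f.chi_self, one_smul] at h2
  rw [← h2, Sec.sum_apply]
  refine Finset.sum_congr rfl fun i _ => ?_
  rw [D.R₀_fsmul (fun y => pairing_eq_zero (he i y) (ha y))]
  rfl

theorem IsMetric.isSec_R₀ (h : D.IsMetric G) {b : Sec n F E} (hb : G.IsSec s b)
    (e a : Sec n F E) : G.IsSec s (D.R₀ e a b) :=
  ((h _ _ _ (h _ _ _ hb)).sub (h _ _ _ (h _ _ _ hb))).sub (h _ _ _ hb)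

theorem IsMetric.toLin_mem (h : D.IsMetric G) {b : Sec n F E} (hb : G.IsSec s b) (x : M)
    (v : E x) : D.toLin b x v ∈ G.V s x := by
  obtain ⟨a, rfl⟩ := C.exists_section_eq x v
  exact h s a b hb x

theorem IsMetric.ricciGF_eq_sum (h : D.IsMetric G) {x : M} (f : C.DualFrame (G.P s) x)
    (a b : Sec n F E) : D.ricciGF G s a b x =
      ∑ i, C.pairing x (f.w i x) (D.R₀ (f.e i) (G.proj (-s) a) (G.proj s b) x) :=
  fiberTrace_eq_sum (G.V s) _ x f.e (fun i y => G.mem_V_iff.2 (f.map_e i y))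
    (fun i => C.form x (f.w i x))
    (fun v hv => by simpa [f.chi_self, P_of_mem hv] using (f.sum_eq x v).symm)
    (fun _ hc => R₀_apply_eq_sum f hc (isSec_proj _ _) _)
    (fun _ => h.isSec_R₀ (isSec_proj _ _) _ _ x)

theorem IsMetric.ricci_eq (h : D.IsMetric G) (a b : Sec n F E) :
    D.ricci G a b = D.ricciGF G 1 a b + D.ricciGF G (-1) a b := by
  funext x
  obtain ⟨f⟩ := G.exists_dualFrame 1 x
  obtain ⟨g⟩ := G.exists_dualFrame (-1) x
  have hf : ∀ i, G.IsSec 1 (f.e i) := fun i y => G.mem_V_iff.2 (f.map_e i y)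
  have hg : ∀ i, G.IsSec (-1) (g.e i) := fun i y => G.mem_V_iff.2 (g.map_e i y)
  have hfw : ∀ i, f.w i x ∈ G.V 1 x := fun i => G.mem_V_iff.2 (f.map_w i x)
  have hgw : ∀ i, g.w i x ∈ G.V (-1) x := fun i => G.mem_V_iff.2 (g.map_w i x)
  have hf' : ∀ i, D.totalCurvature G (f.e i) a b = D.R₀ (f.e i) (G.proj (-1) a) b := fun i => by
    rw [totalCurvature, (hf i).proj_eq, (hf i).proj_neg_eq, D.R₀_zero, add_zero]
  have hg' : ∀ i, D.totalCurvature G (g.e i) a b = D.R₀ (g.e i) (G.proj 1 a) b := fun i => by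
    rw [totalCurvature, (hg i).proj_eq, (hg i).proj_of_neg, D.R₀_zero, zero_add]
  -- The frames of `V₊` and `V₋` together span `E`; on each of them only one half of the total
  -- curvature survives.
  have key := fiberTrace_eq_sum (fun _ => ⊤) (fun e => D.totalCurvature G e a b) x
    (Sum.elim f.e g.e) (fun _ _ => trivial)
    (Sum.elim (fun i => C.form x (f.w i x)) (fun i => C.form x (g.w i x)))
    (fun v _ => by
      simpa [f.chi_self, g.chi_self, f.sum_eq, g.sum_eq] using (G.P_add_P_neg 1 x v).symm)
    (fun c _ => by
      simp only [Fintype.sum_sum_type, Sum.elim_inl, Sum.elim_inr, hf', hg']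
      rw [totalCurvature, Sec.add_apply, R₀_apply_eq_sum f (isSec_proj 1 c) (isSec_proj (-1) a),
        R₀_apply_eq_sum g (isSec_proj (-1) c) (by simpa using isSec_proj 1 a)]
      simp only [proj_apply, pairing_P_right (hfw _), pairing_P_right (hgw _)]
      rfl)
    (fun _ => trivial)
  rw [ricci, key, Pi.add_apply, h.ricciGF_eq_sum f, h.ricciGF_eq_sum g]
  simp only [Fintype.sum_sum_type, Sum.elim_inl, Sum.elim_inr, hf', hg', form_apply, neg_neg]
  congr 1
  · refine Finset.sum_congr rfl fun i _ => ?_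
    conv_lhs => rw [← proj_add_proj_neg (G := G) 1 b, D.R₀_add_right, Sec.add_apply, map_add,
      pairing_eq_zero (hfw i) (h.isSec_R₀ (isSec_proj (-1) b) _ _ x), add_zero]
  · refine Finset.sum_congr rfl fun i _ => ?_
    conv_lhs => rw [← proj_add_proj_neg (G := G) 1 b, D.R₀_add_right, Sec.add_apply, map_add,
      pairing_eq_zero' (hgw i) (h.isSec_R₀ (isSec_proj 1 b) _ _ x), zero_add]

end Connection

end CourantAlgebroid

/-! ### The curvature in terms of brackets and divergence, and its symmetry. -/

namespace CourantAlgebroid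

variable {C : CourantAlgebroid n F E} [T2Space M] [FiniteDimensional ℝ F]

open GeneralizedMetric

theorem contMDiffMap_sum_apply {ι : Type*} (t : Finset ι) (f : ι → C^∞⟮𝓡 n, M; ℝ⟯) (x : M) :
    (∑ i ∈ t, f i) x = ∑ i ∈ t, f i x := by
  classical
  induction t using Finset.induction_on with
  | empty => rfl
  | insert i t hi h => rw [Finset.sum_insert hi, Finset.sum_insert hi, ← h]; rfl

namespace Connection

variable {D : C.Connection} {G : C.GeneralizedMetric} {δ : C.Divergence} {s : ℤˣ}

theorem torsion_eq (D : C.Connection) (a b c : Sec n F E) (x : M) :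
    D.torsion a b c x = C.pairing x (D.toLin b x (a x)) (c x) -
      C.pairing x (D.toLin a x (b x)) (c x) - C.pairing x (C.bracket a b x) (c x) +
      C.pairing x (b x) (D.toLin a x (c x)) := by
  simp [torsion]

theorem IsPureType.torsion_eq_zero (h : D.IsPureType G) {a b : Sec n F E}
    (ha : G.IsSec (-s) a) (hb : G.IsSec s b) (c : Sec n F E) (x : M) :
    D.torsion a b c x = 0 := by
  have h0 : ∀ (u c : Sec n F E), D.torsion u 0 c x = 0 := fun u c => by simp [torsion_eq]
  have h0' : ∀ (u c : Sec n F E), D.torsion 0 u c x = 0 := fun u c => by simp [torsion_eq]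
  rw [h]
  rcases Int.units_eq_one_or s with rfl | rfl
  · rw [ha.proj_of_neg, hb.proj_neg_eq, h0, h0', add_zero]
  · rw [neg_neg] at ha
    rw [ha.proj_neg_eq, hb.proj_of_neg, h0, h0', add_zero]

/-- In `⟨T(a,b), c⟩ = 0` with `c` in `V_s`, both terms containing `D a` pair `V_s` with `V_{-s}` and
vanish. -/
theorem nabla_eq_proj_bracket (hm : D.IsMetric G) (hp : D.IsPureType G) {a b : Sec n F E}
    (ha : G.IsSec (-s) a) (hb : G.IsSec s b) : D.nabla a b = G.proj s (C.bracket a b) := by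
  ext x
  refine C.eq_of_pairing_section fun c => ?_
  have h1 := hp.torsion_eq_zero ha hb (G.proj s c) x
  rw [torsion_eq, pairing_eq_zero' (hm.toLin_mem ha x _) (isSec_proj s c x),
    pairing_eq_zero (hb x) (hm.toLin_mem ha x _)] at h1
  rw [proj_apply] at h1
  rw [nabla_apply, proj_apply, pairing_P, ← pairing_P_right (hm.toLin_mem hb x _)]
  linarith

/-- The contribution to the trace of the curvature that involves only brackets. -/
def bracketTrace {x : M} (f : C.DualFrame (G.P s) x) (a b : Sec n F E) : ℝ :=
  ∑ i, C.pairing x (f.w i x) (C.bracket (G.proj (-s) (C.bracket a (f.e i))) b x)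

/-- The tensor `∑ w_i ⊗ e_i` is invariant along `a` up to projection: apply `[a, ·]` to `χ v = ∑
⟨w_i, v⟩ e_i`, whose cutoff is constant near `x`. -/
theorem sum_bracket_frame {x : M} (f : C.DualFrame (G.P s) x) (a : Sec n F E) {v : Sec n F E}
    (hv : G.IsSec s v) :
    ∑ i, (C.pairing x (C.bracket a (f.w i) x) (v x) • f.e i x +
      C.pairing x (f.w i x) (v x) • G.P s x (C.bracket a (f.e i) x)) = 0 := by
  have h1 := congrArg (fun c => G.P s x (C.bracket a c x))
    (f.fsmul_chi (c := v) fun y => P_of_mem (hv y))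
  simp only [map_sum, Sec.sum_apply, C.bracket_fsmul, f.chi_self, f.lie_chi, C.invariance_pair,
    map_add, map_smul, f.map_e, pair_apply, one_smul, zero_smul, add_zero, add_smul] at h1
  have h2 := f.sum_eq x (C.bracket a v x)
  rw [f.chi_self, one_smul] at h2
  simp only [Finset.sum_add_distrib] at h1 ⊢
  rw [h2] at h1
  linear_combination (norm := module) -h1

theorem sum_bracket_trace {x : M} (f : C.DualFrame (G.P s) x) (a : Sec n F E)
    (A : E x →ₗ[ℝ] E x) (hA : ∀ v, A v ∈ G.V s x) :
    ∑ i, (C.pairing x (C.bracket a (f.w i) x) (A (f.e i x)) +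
      C.pairing x (f.w i x) (A (G.P s x (C.bracket a (f.e i) x)))) = 0 := by
  have := finite_fiber (F := F) (E := E) x
  have hw : ∀ i, f.w i x ∈ G.V s x := fun i => G.mem_V_iff.2 (f.map_w i x)
  have h : ∑ i, ((C.form x (G.P s x (C.bracket a (f.w i) x))).smulRight (A (f.e i x)) +
      (C.form x (f.w i x)).smulRight (A (G.P s x (C.bracket a (f.e i) x)))) = 0 := by
    ext v
    obtain ⟨c, rfl⟩ := C.exists_section_eq x v
    have := congrArg A (sum_bracket_frame f a (isSec_proj s c))
    simpa [pairing_P, pairing_P_right (hw _)] using this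
  have h' := congrArg (LinearMap.trace ℝ (E x)) h
  simpa [map_sum, LinearMap.trace_smulRight, pairing_P_left (hA _)] using h'

theorem IsAdapted.sum_R₀ (h : D.IsAdapted G δ) {x : M} (f : C.DualFrame (G.P s) x)
    {a b : Sec n F E} (ha : G.IsSec (-s) a) (hb : G.IsSec s b) :
    ∑ i, C.pairing x (f.w i x) (D.R₀ (f.e i) a b x) =
      δ.toLin (G.proj s (C.bracket a b)) x - C.lie (δ.toLin b) x (a x) + bracketTrace f a b := by
  have hm := h.isMetric
  have hw : ∀ i y, f.w i y ∈ G.V s y := fun i y => G.mem_V_iff.2 (f.map_w i y)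
  have he : ∀ i, G.IsSec s (f.e i) := fun i y => G.mem_V_iff.2 (f.map_e i y)
  have hdiv : ∀ {c : Sec n F E}, G.IsSec s c → ∀ y,
      ∑ i, C.pairing y (f.w i y) (D.toLin c y (f.e i y)) = f.χ y * δ.toLin c y := by
    intro c hc y
    rw [h.hasDivergence]
    exact f.sum_pairing y (D.toLin c y : E y →ₗ[ℝ] E y) fun v => P_of_mem (hm.toLin_mem hc y v)
  have hX := hdiv (isSec_proj s (C.bracket a b)) x
  rw [f.chi_self, one_mul] at hX
  -- The trace formula `χ div b = ∑ ⟨w_i, D_{e_i} b⟩` is differentiated along `a`; it must therefore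
  -- hold on all of `M`, with the cutoff kept.
  have hlie : C.lie (δ.toLin b) x (a x) =
      ∑ i, (C.pairing x (C.bracket a (f.w i) x) (D.toLin b x (f.e i x)) +
        C.pairing x (f.w i x) (C.bracket a (D.nabla (f.e i) b) x)) := by
    have h1 : f.χ * δ.toLin b = ∑ i, C.pair (f.w i) (D.nabla (f.e i) b) := by
      ext y
      rw [contMDiffMap_sum_apply]
      exact (hdiv hb y).symm
    have h2 := C.lie_mul f.χ (δ.toLin b) x (a x)
    rw [f.chi_self, f.lie_chi, one_mul, mul_zero, add_zero, h1, C.lie_sum] at h2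
    rw [← h2]
    simp only [C.invariance_pair, nabla_apply]
  -- This cancels the terms in which the bracket with `a` hits the frame itself.
  have htr := sum_bracket_trace f a (D.toLin b x : E x →ₗ[ℝ] E x) (hm.toLin_mem hb x)
  have hR : ∀ i, C.pairing x (f.w i x) (D.R₀ (f.e i) a b x) =
      C.pairing x (f.w i x) (D.toLin (G.proj s (C.bracket a b)) x (f.e i x)) -
      C.pairing x (f.w i x) (C.bracket a (D.nabla (f.e i) b) x) +
      C.pairing x (f.w i x) (D.toLin b x (G.P s x (C.bracket a (f.e i) x))) +
      C.pairing x (f.w i x) (C.bracket (G.proj (-s) (C.bracket a (f.e i))) b x) := by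
    intro i
    have hbr : C.bracket (f.e i) a = -C.bracket a (f.e i) :=
      C.bracket_skew fun y => pairing_eq_zero (he i y) (ha y)
    -- Along the `V_{-s}`-part of `[a, e_i]` the derivative of `b` is a bracket again; this is the
    -- source of `bracketTrace`.
    have hsplit : D.toLin b x (C.bracket a (f.e i) x) =
        D.toLin b x (G.P s x (C.bracket a (f.e i) x)) +
          G.P s x (C.bracket (G.proj (-s) (C.bracket a (f.e i))) b x) := by
      rw [← proj_apply G s (C.bracket (G.proj (-s) (C.bracket a (f.e i))) b),
        ← nabla_eq_proj_bracket hm h.isPureType (isSec_proj _ _) hb, nabla_apply,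
        proj_apply, ← map_add, G.P_add_P_neg]
    rw [R₀, nabla_eq_proj_bracket hm h.isPureType ha hb,
      nabla_eq_proj_bracket hm h.isPureType ha (hm s (f.e i) b hb), hbr]
    simp only [Sec.sub_apply, nabla_apply, Sec.neg_apply, map_sub, map_neg, proj_apply, hsplit,
      map_add, pairing_P_right (hw i x)]
    ring
  simp only [hR, Finset.sum_add_distrib, Finset.sum_sub_distrib, bracketTrace] at htr hlie ⊢
  rw [hX, hlie]
  simp only [ContinuousLinearMap.coe_coe] at htr
  linarith

theorem IsAdapted.ricciGF_eq (h : D.IsAdapted G δ) {x : M} (f : C.DualFrame (G.P s) x)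
    (a b : Sec n F E) : D.ricciGF G s a b x =
      δ.toLin (G.proj s (C.bracket (G.proj (-s) a) (G.proj s b))) x -
        C.lie (δ.toLin (G.proj s b)) x (G.proj (-s) a x) +
          bracketTrace f (G.proj (-s) a) (G.proj s b) := by
  rw [h.isMetric.ricciGF_eq_sum f, h.sum_R₀ f (isSec_proj _ _) (isSec_proj _ _)]

theorem IsAdapted.ricciGF_congr {D' : C.Connection} (h : D.IsAdapted G δ)
    (h' : D'.IsAdapted G δ) (s : ℤˣ) : D.ricciGF G s = D'.ricciGF G s := by
  funext a b x
  obtain ⟨f⟩ := G.exists_dualFrame s x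
  rw [h.ricciGF_eq f, h'.ricciGF_eq f]

/-- Inserting both frames turns each side into a double sum of products of two bracket coefficients.
Moving a bracket across a pairing of orthogonal sections changes the sign; every product has two
such factors, so the signs cancel. -/
theorem bracketTrace_symm {x : M} (f : C.DualFrame (G.P s) x) (g : C.DualFrame (G.P (-s)) x)
    {a b : Sec n F E} (ha : G.IsSec (-s) a) (hb : G.IsSec s b) :
    bracketTrace f a b = bracketTrace g b a := by
  have hw : ∀ i, G.IsSec s (f.w i) := fun i y => G.mem_V_iff.2 (f.map_w i y)
  have he : ∀ i, G.IsSec s (f.e i) := fun i y => G.mem_V_iff.2 (f.map_e i y)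
  have hgw : ∀ i, G.IsSec (-s) (g.w i) := fun i y => G.mem_V_iff.2 (g.map_w i y)
  have hge : ∀ i, G.IsSec (-s) (g.e i) := fun i y => G.mem_V_iff.2 (g.map_e i y)
  have hlie : ∀ (c : Sec n F E) {u v : Sec n F E}, (∀ y, C.pairing y (u y) (v y) = 0) →
      C.pairing x (C.bracket c u x) (v x) + C.pairing x (u x) (C.bracket c v x) = 0 := by
    intro c u v huv
    rw [← C.invariance_pair,
      C.lie_congr (f := C.pair u v) (g := fun _ => 0) (.of_forall huv), C.lie_const]
  have h1 : ∀ i, C.pairing x (f.w i x) (C.bracket (G.proj (-s) (C.bracket a (f.e i))) b x) =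
      C.pairing x (C.bracket b (f.w i) x) (G.P (-s) x (C.bracket a (f.e i) x)) := by
    intro i
    have h2 := hlie b (u := f.w i) (v := G.proj (-s) (C.bracket a (f.e i)))
      fun y => pairing_eq_zero (hw i y) (isSec_proj (-s) _ y)
    rw [C.bracket_skew fun y => pairing_eq_zero' (isSec_proj (-s) _ y) (hb y), Sec.neg_apply,
      map_neg]
    rw [proj_apply] at h2
    linarith
  have h1' : ∀ j, C.pairing x (g.w j x) (C.bracket (G.proj (- -s) (C.bracket b (g.e j))) a x) =
      C.pairing x (C.bracket a (g.w j) x) (G.P s x (C.bracket b (g.e j) x)) := by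
    intro j
    rw [neg_neg]
    have h2 := hlie a (u := g.w j) (v := G.proj s (C.bracket b (g.e j)))
      fun y => pairing_eq_zero' (hgw j y) (isSec_proj s _ y)
    rw [C.bracket_skew fun y => pairing_eq_zero (isSec_proj s _ y) (ha y), Sec.neg_apply,
      map_neg]
    rw [proj_apply] at h2
    linarith
  have h3 : ∀ v, G.P (-s) x v = ∑ j, C.pairing x (g.w j x) v • g.e j x := fun v => by
    rw [g.sum_eq, g.chi_self, one_smul]
  have h3' : ∀ v, G.P s x v = ∑ j, C.pairing x (f.w j x) v • f.e j x := fun v => by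
    rw [f.sum_eq, f.chi_self, one_smul]
  simp only [bracketTrace, h1, h1', h3, h3', map_sum, map_smul, smul_eq_mul]
  rw [Finset.sum_comm]
  refine Finset.sum_congr rfl fun j _ => Finset.sum_congr rfl fun i _ => ?_
  have h4 := hlie a (u := g.w j) (v := f.e i) fun y => pairing_eq_zero' (hgw j y) (he i y)
  have h5 := hlie b (u := f.w i) (v := g.e j) fun y => pairing_eq_zero (hw i y) (hge j y)
  rw [eq_neg_of_add_eq_zero_left h4, eq_neg_of_add_eq_zero_left h5]
  ring

theorem IsAdapted.ricciGF_sub (h : D.IsAdapted G δ) {a b : Sec n F E} (ha : G.IsSec (-s) a)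
    (hb : G.IsSec s b) (x : M) :
    D.ricciGF G s a b x - D.ricciGF G (-s) b a x =
      δ.toLin (C.bracket a b) x - C.lie (δ.toLin b) x (a x) + C.lie (δ.toLin a) x (b x) := by
  obtain ⟨f⟩ := G.exists_dualFrame s x
  obtain ⟨g⟩ := G.exists_dualFrame (-s) x
  rw [h.ricciGF_eq f, h.ricciGF_eq g, neg_neg, ha.proj_eq, hb.proj_eq, bracketTrace_symm f g ha hb,
    C.bracket_skew (a := b) (b := a) fun y => pairing_eq_zero (hb y) (ha y)]
  conv_rhs => rw [← proj_add_proj_neg (G := G) s (C.bracket a b), map_add]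
  have h1 : G.proj (-s) (-C.bracket a b) = -G.proj (-s) (C.bracket a b) := by ext y; simp
  rw [h1, map_neg]
  change _ - (-(δ.toLin (G.proj (-s) (C.bracket a b)) x) - _ + _) =
    δ.toLin (G.proj s (C.bracket a b)) x + δ.toLin (G.proj (-s) (C.bracket a b)) x - _ + _
  ring

theorem ricciGF_proj (D : C.Connection) (a b : Sec n F E) :
    D.ricciGF G s a b = D.ricciGF G s (G.proj (-s) a) (G.proj s b) := by
  simp only [ricciGF, (isSec_proj (-s) a).proj_eq, (isSec_proj s b).proj_eq]

theorem IsMetric.ricciGF_eq_zero (h : D.IsMetric G) {a b : Sec n F E} (ha : G.IsSec s a)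
    (hb : G.IsSec (-s) b) : D.ricciGF G s a b = 0 := by
  funext x
  obtain ⟨f⟩ := G.exists_dualFrame s x
  have h00 : ∀ e, D.nabla e 0 = 0 := fun e => by ext y; simp
  have h0 : ∀ e, D.R₀ e 0 0 = 0 := fun e => by simp [R₀, h00]
  rw [h.ricciGF_eq_sum f, ha.proj_neg_eq, hb.proj_of_neg]
  simp [h0]

theorem IsMetric.ricci_eq_add_neg (h : D.IsMetric G) (s : ℤˣ) (a b : Sec n F E) (x : M) :
    D.ricci G a b x = D.ricciGF G s a b x + D.ricciGF G (-s) a b x := by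
  rw [h.ricci_eq]
  rcases Int.units_eq_one_or s with rfl | rfl
  · rfl
  · rw [neg_neg, add_comm]
    rfl

theorem IsAdapted.ricci_symm_iff (h : D.IsAdapted G δ) :
    (∀ a b, D.ricci G a b = D.ricci G b a) ↔ IsCompatible G δ := by
  constructor
  · intro hs s a b ha hb x
    have h1 := congrFun (hs a b) x
    -- For `a` in `V_{-s}` and `b` in `V_s` a single half of the curvature survives in each order of
    -- the arguments.
    rw [h.isMetric.ricci_eq_add_neg s, h.isMetric.ricci_eq_add_neg s b a,
      h.isMetric.ricciGF_eq_zero (s := -s) ha (by rwa [neg_neg]),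
      h.isMetric.ricciGF_eq_zero (s := s) hb ha] at h1
    rw [← h.ricciGF_sub ha hb]
    simp only [Pi.zero_apply] at h1
    linarith
  · intro hc a b
    have key : ∀ (s : ℤˣ) (a b : Sec n F E) (x : M),
        D.ricciGF G s a b x = D.ricciGF G (-s) b a x := by
      intro s a b x
      have h1 := h.ricciGF_sub (isSec_proj (-s) a) (isSec_proj s b) x
      rw [hc s _ _ (isSec_proj (-s) a) (isSec_proj s b)] at h1
      rw [ricciGF_proj, ricciGF_proj D b a, neg_neg]
      linarith
    funext x
    rw [h.isMetric.ricci_eq_add_neg 1, h.isMetric.ricci_eq_add_neg 1 b a, key 1 a b, key 1 b a,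
      add_comm]

theorem IsAdapted.ricci_congr {D' : C.Connection} (h : D.IsAdapted G δ)
    (h' : D'.IsAdapted G δ) : D.ricci G = D'.ricci G := by
  funext a b
  rw [h.isMetric.ricci_eq, h'.isMetric.ricci_eq, h.ricciGF_congr h', h.ricciGF_congr h']

end Connection

end CourantAlgebroid

/-! ### From tensorial operators to smooth sections. -/

namespace CourantAlgebroid

variable (C : CourantAlgebroid n F E) [T2Space M] [FiniteDimensional ℝ F]

open GeneralizedMetric

/-- The Lie derivative of `f` along the anchor of `a`, as a smooth function. -/
def Divergence.lieMap {C : CourantAlgebroid n F E} (δ : C.Divergence) (a : Sec n F E)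
    (f : C^∞⟮𝓡 n, M; ℝ⟯) : C^∞⟮𝓡 n, M; ℝ⟯ := δ.toLin (fsmul f a) - f * δ.toLin a

@[simp]
theorem Divergence.lieMap_apply {C : CourantAlgebroid n F E} (δ : C.Divergence) (a : Sec n F E)
    (f : C^∞⟮𝓡 n, M; ℝ⟯) (x : M) : δ.lieMap a f x = C.lie f x (a x) := by
  change δ.toLin (fsmul f a) x - f x * δ.toLin a x = _
  rw [δ.leibniz]
  ring

theorem EndSec_ext {A B : EndSec n F E} (C : CourantAlgebroid n F E)
    (h : ∀ e : Sec n F E, A.app e = B.app e) : A = B := by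
  ext x v
  obtain ⟨e, rfl⟩ := C.exists_section_eq x v
  exact DFunLike.congr_fun (h e) x

@[simp]
theorem EndSec_sum_apply {ι : Type*} (t : Finset ι) (A : ι → EndSec n F E) (x : M) (v : E x) :
    (∑ i ∈ t, A i) x v = ∑ i ∈ t, A i x v := by
  classical
  induction t using Finset.induction_on with
  | empty => rfl
  | insert i t hi h => rw [Finset.sum_insert hi, Finset.sum_insert hi, ← h]; rfl

/-- The trace of a field of endomorphisms, as a smooth function. -/
def traceMap (C : CourantAlgebroid n F E) (A : EndSec n F E) : C^∞⟮𝓡 n, M; ℝ⟯ :=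
  ⟨fun x => LinearMap.trace ℝ (E x) (A x : E x →ₗ[ℝ] E x), fun x => by
    obtain ⟨f⟩ := C.exists_dualFrame x
    refine ((∑ i, C.pair (f.w i) (A.app (f.e i)) : C^∞⟮𝓡 n, M; ℝ⟯).contMDiff
      x).congr_of_eventuallyEq ?_
    filter_upwards [f.eventually_one] with y hy
    have := f.sum_pairing y (A y : E y →ₗ[ℝ] E y) fun _ => rfl
    rw [hy, one_mul] at this
    rw [← this, contMDiffMap_sum_apply]
    rfl⟩

@[simp]
theorem traceMap_apply (A : EndSec n F E) (x : M) :
    C.traceMap A x = LinearMap.trace ℝ (E x) (A x : E x →ₗ[ℝ] E x) := rfl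

theorem DualFrame.sum_pairing_e {C : CourantAlgebroid n F E} {x : M}
    (f : C.DualFrame (fun _ => LinearMap.id) x) (y : M) (v : E y) :
    ∑ i, C.pairing y (f.e i y) v • f.w i y = f.χ y • v := by
  refine C.eq_of_pairing_section fun c => ?_
  have := congrArg (fun u => C.pairing y u v) (f.sum_eq y (c y))
  simp at this ⊢
  rw [C.pairing_symm y v, ← this]
  exact Finset.sum_congr rfl fun i _ => mul_comm _ _

variable [SigmaCompactSpace M]

/-- Near each point a dual frame gives the solution `∑ ⟨w_i, ·⟩ T e_i`; the condition on the value
at a point is convex, so local solutions glue. -/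
theorem exists_endSec (C : CourantAlgebroid n F E) (T : Sec n F E →ₗ[ℝ] Sec n F E)
    (hT : ∀ (f : C^∞⟮𝓡 n, M; ℝ⟯) e, T (fsmul f e) = fsmul f (T e)) :
    ∃ A : EndSec n F E, ∀ e, A.app e = T e := by
  obtain ⟨A, hA⟩ := exists_contMDiffSection_forall_mem_convex_of_local (𝓡 n) (n := ⊤)
    (F_fiber := F →L[ℝ] F) (fun x : M => E x →L[ℝ] E x)
    (fun x => {A | ∀ e : Sec n F E, A (e x) = T e x})
    (fun x => by
      intro A hA B hB p q _ _ hpq e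
      simp only [Set.mem_ofPred_eq] at hA hB ⊢
      simp [hA, hB, ← add_smul, hpq])
    (fun x => by
      obtain ⟨f⟩ := C.exists_dualFrame x
      refine ⟨{y | f.χ y = 1}, f.eventually_one,
        (∑ i, C.rankOne (f.w i) (T (f.e i)) : EndSec n F E),
        (∑ i, C.rankOne (f.w i) (T (f.e i)) : EndSec n F E).contMDiff.contMDiffOn,
        fun y hy e => ?_⟩
      change f.χ y = 1 at hy
      have h1 := hT f.χ e
      rw [f.fsmul_chi fun _ => rfl, map_sum] at h1
      have h2 := DFunLike.congr_fun h1 y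
      simp only [hT, Sec.sum_apply, fsmul_apply, hy, one_smul] at h2
      rw [← h2, EndSec_sum_apply]
      simp)
  exact ⟨A, fun e => by ext x; exact hA x e⟩

theorem exists_section_pairing (φ : Sec n F E →ₗ[ℝ] C^∞⟮𝓡 n, M; ℝ⟯)
    (hφ : ∀ (f : C^∞⟮𝓡 n, M; ℝ⟯) e, φ (fsmul f e) = f * φ e) :
    ∃ u : Sec n F E, ∀ e, C.pair u e = φ e := by
  obtain ⟨u, hu⟩ := exists_contMDiffSection_forall_mem_convex_of_local (𝓡 n) (n := ⊤)
    (F_fiber := F) E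
    (fun x => {u | ∀ e : Sec n F E, C.pairing x u (e x) = φ e x})
    (fun x => by
      intro u hu v hv p q _ _ hpq e
      simp only [Set.mem_ofPred_eq] at hu hv ⊢
      simp [hu, hv, ← add_mul, hpq])
    (fun x => by
      obtain ⟨f⟩ := C.exists_dualFrame x
      refine ⟨{y | f.χ y = 1}, f.eventually_one,
        (∑ i, fsmul (φ (f.e i)) (f.w i) : Sec n F E),
        (∑ i, fsmul (φ (f.e i)) (f.w i) : Sec n F E).contMDiff.contMDiffOn,
        fun y hy e => ?_⟩
      change f.χ y = 1 at hy
      have h1 := hφ f.χ e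
      rw [f.fsmul_chi fun _ => rfl, map_sum] at h1
      have h2 := DFunLike.congr_fun h1 y
      rw [contMDiffMap_sum_apply] at h2
      have h3 : (f.χ * φ e) y = φ e y := by
        change f.χ y * φ e y = _
        rw [hy, one_mul]
      rw [← h3, ← h2, Sec.sum_apply]
      simp only [hφ, map_sum, _root_.sum_apply, fsmul_apply, map_smul]
      refine Finset.sum_congr rfl fun i _ => ?_
      exact mul_comm _ _)
  exact ⟨u, fun e => by ext x; exact hu x e⟩

theorem exists_linearMap_endSec (C : CourantAlgebroid n F E)
    (N : Sec n F E →ₗ[ℝ] Sec n F E →ₗ[ℝ] Sec n F E)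
    (hN : ∀ (f : C^∞⟮𝓡 n, M; ℝ⟯) a v, N a (fsmul f v) = fsmul f (N a v)) :
    ∃ L : Sec n F E →ₗ[ℝ] EndSec n F E, ∀ a v, (L a).app v = N a v := by
  choose A hA using fun a => C.exists_endSec (N a) (fun f v => hN f a v)
  refine ⟨⟨⟨A, fun a b => EndSec_ext C fun e => ?_⟩, fun r a => EndSec_ext C fun e => ?_⟩, hA⟩
  · rw [hA, map_add, LinearMap.add_apply, ← hA, ← hA]
    rfl
  · rw [hA, map_smul, LinearMap.smul_apply, ← hA]
    rfl

end CourantAlgebroid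

/-! ### Existence of a generalized connection. -/

namespace CourantAlgebroid

variable {C : CourantAlgebroid n F E} [T2Space M] [FiniteDimensional ℝ F]

theorem lie_smul (C : CourantAlgebroid n F E) (r : ℝ) (f : C^∞⟮𝓡 n, M; ℝ⟯) (x : M) (v : E x) :
    C.lie (r • f : C^∞⟮𝓡 n, M; ℝ⟯) x v = r * C.lie f x v := by
  have h := C.lie_mul (ContMDiffMap.const r) f x v
  rw [show C.lie (ContMDiffMap.const r : C^∞⟮𝓡 n, M; ℝ⟯) x v = 0 from C.lie_const r x v, mul_zero,
    add_zero] at h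
  exact h

namespace DualFrame

variable {x : M} (f : C.DualFrame (fun _ => LinearMap.id) x)

/-- The metric connection on `E` near `x` for which `w i` and `e i` are, up to symmetrization,
the images of the standard frame of a trivial bundle with its trivial connection. -/
def localNabla (δ : C.Divergence) (a v : Sec n F E) : Sec n F E :=
  (1 / 2 : ℝ) • ∑ i, (fsmul (δ.lieMap v (C.pair (f.w i) a)) (f.e i) +
    fsmul (δ.lieMap v (C.pair (f.e i) a)) (f.w i))

variable (δ : C.Divergence)

theorem localNabla_apply (a v : Sec n F E) (y : M) : f.localNabla δ a v y =
    (1 / 2 : ℝ) • ∑ i, (C.lie (C.pair (f.w i) a) y (v y) • f.e i y +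
      C.lie (C.pair (f.e i) a) y (v y) • f.w i y) := by
  simp [localNabla]

theorem localNabla_add_left (a b v : Sec n F E) :
    f.localNabla δ (a + b) v = f.localNabla δ a v + f.localNabla δ b v := by
  ext y
  have h : ∀ c : Sec n F E, C.pair c (a + b) = C.pair c a + C.pair c b := fun c => by
    ext z; exact map_add (C.pairing z (c z)) _ _
  simp only [localNabla_apply, Sec.add_apply, h, lie_add, ← smul_add, ← Finset.sum_add_distrib]
  congr 1
  exact Finset.sum_congr rfl fun i _ => by module

theorem localNabla_smul_left (r : ℝ) (a v : Sec n F E) :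
    f.localNabla δ (r • a) v = r • f.localNabla δ a v := by
  ext y
  have h : ∀ c : Sec n F E, C.pair c (r • a) = r • C.pair c a := fun c => by
    ext z; exact map_smul (C.pairing z (c z)) _ _
  simp only [localNabla_apply, Sec.smul_apply, h, lie_smul, smul_comm r (1 / 2 : ℝ),
    Finset.smul_sum]
  exact Finset.sum_congr rfl fun i _ => by module

theorem localNabla_add_right (a v w : Sec n F E) :
    f.localNabla δ a (v + w) = f.localNabla δ a v + f.localNabla δ a w := by
  ext y
  simp only [localNabla_apply, Sec.add_apply, lie_add_right, ← smul_add,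
    ← Finset.sum_add_distrib]
  congr 1
  exact Finset.sum_congr rfl fun i _ => by module

theorem localNabla_fsmul_right (g : C^∞⟮𝓡 n, M; ℝ⟯) (a v : Sec n F E) :
    f.localNabla δ a (fsmul g v) = fsmul g (f.localNabla δ a v) := by
  ext y
  simp only [localNabla_apply, fsmul_apply, lie_smul_right, smul_comm (g y) (1 / 2 : ℝ),
    Finset.smul_sum]
  exact Finset.sum_congr rfl fun i _ => by module

theorem localNabla_fsmul_left (g : C^∞⟮𝓡 n, M; ℝ⟯) (a v : Sec n F E) {y : M}
    (hy : f.χ y = 1) : f.localNabla δ (fsmul g a) v y =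
      g y • f.localNabla δ a v y + C.lie g y (v y) • a y := by
  have h : ∀ c : Sec n F E, C.pair c (fsmul g a) = g * C.pair c a := fun c => by
    ext z; exact map_smul (C.pairing z (c z)) _ _
  have h1 := f.sum_eq y (a y)
  have h2 := f.sum_pairing_e y (a y)
  rw [hy, one_smul] at h1 h2
  -- Averages the expansion of `a` in the frame with the one in which `e` and `w` are exchanged, as
  -- in `localNabla`.
  have h3 : a y = (1 / 2 : ℝ) • ∑ i, (C.pairing y (f.w i y) (a y) • f.e i y +
      C.pairing y (f.e i y) (a y) • f.w i y) := by
    rw [Finset.sum_add_distrib, h1, h2]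
    change a y = (1 / 2 : ℝ) • (a y + a y)
    module
  conv_rhs => rw [h3]
  simp only [localNabla_apply, h, lie_mul, pair_apply, smul_comm (g y) (1 / 2 : ℝ),
    smul_comm (C.lie g y (v y)) (1 / 2 : ℝ), Finset.smul_sum, ← Finset.sum_add_distrib]
  exact Finset.sum_congr rfl fun i _ => by module

/-- Symmetrization makes the connection metric: the four kinds of terms are the product rule for `∑
⟨w_i,a⟩⟨e_i,b⟩` and for the same sum with `e`, `w` exchanged, both equal to `χ⟨a,b⟩`. -/
theorem localNabla_pairing (a b v : Sec n F E) {y : M} (hy : ∀ᶠ z in nhds y, f.χ z = 1) :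
    C.pairing y (f.localNabla δ a v y) (b y) + C.pairing y (a y) (f.localNabla δ b v y) =
      C.lie (C.pair a b) y (v y) := by
  have h1 : ∑ i, (C.pair (f.w i) a * C.pair (f.e i) b) = f.χ * C.pair a b := by
    ext z
    rw [contMDiffMap_sum_apply]
    have := congrArg (fun u => C.pairing z u (b z)) (f.sum_eq z (a z))
    simpa using! this
  have h2 : ∑ i, (C.pair (f.e i) a * C.pair (f.w i) b) = f.χ * C.pair a b := by
    ext z
    rw [contMDiffMap_sum_apply]
    have := congrArg (fun u => C.pairing z u (b z)) (f.sum_pairing_e z (a z))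
    simpa using! this
  have h3 : C.lie (f.χ * C.pair a b : C^∞⟮𝓡 n, M; ℝ⟯) y (v y) = C.lie (C.pair a b) y (v y) := by
    refine C.lie_congr ?_ _
    filter_upwards [hy] with z hz
    change f.χ z * C.pair a b z = _
    rw [hz, one_mul]
  have h4 := congrArg (fun g : C^∞⟮𝓡 n, M; ℝ⟯ => C.lie g y (v y)) h1
  have h5 := congrArg (fun g : C^∞⟮𝓡 n, M; ℝ⟯ => C.lie g y (v y)) h2
  simp only [lie_sum, lie_mul, h3, pair_apply] at h4 h5
  simp only [localNabla_apply, map_smul, map_sum, map_add, _root_.sum_apply, _root_.add_apply,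
    _root_.smul_apply, smul_eq_mul, C.pairing_symm y (a y), Finset.mul_sum]
  rw [← Finset.sum_add_distrib]
  have h6 := congrArg₂ (fun p q : ℝ => 1 / 2 * (p + q)) h4 h5
  rw [← Finset.sum_add_distrib, Finset.mul_sum] at h6
  calc _ = _ := Finset.sum_congr rfl fun i _ => ?_
    _ = _ := h6
    _ = _ := by ring
  ring

end DualFrame

variable [SigmaCompactSpace M]

/-- The defining conditions are affine, so a partition of unity glues the local connections. The
divergence enters only through `Divergence.lieMap`, which exhibits Lie derivatives as smooth
functions. -/
theorem Divergence.nonempty_connection (δ : C.Divergence) : Nonempty C.Connection := by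
  let f (x : M) : C.DualFrame (fun _ => LinearMap.id) x := Classical.choice (C.exists_dualFrame x)
  obtain ⟨ψ, hψ⟩ := SmoothPartitionOfUnity.exists_isSubordinate (𝓡 n) isClosed_univ
    (fun x => interior {y | (f x).χ y = 1}) (fun _ => isOpen_interior)
    (fun x _ => Set.mem_iUnion.2 ⟨x, mem_interior_iff_mem_nhds.2 (f x).eventually_one⟩)
  have hone : ∀ i y, ψ i y ≠ 0 → ∀ᶠ z in nhds y, (f i).χ z = 1 := fun i y hy =>
    mem_interior_iff_mem_nhds.1 (hψ i (subset_closure hy))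
  let N (a v : Sec n F E) : Sec n F E := ⟨fun y => ∑ᶠ i, ψ i y • (f i).localNabla δ a v y,
    ContMDiff.finsum_section_of_locallyFinite
      (ψ.locallyFinite.subset fun i y hy => left_ne_zero_of_smul hy)
      (fun i => (ψ i).contMDiff.smul_section ((f i).localNabla δ a v).contMDiff)⟩
  have hN : ∀ a v y, N a v y = ∑ i ∈ ψ.finsupport y, ψ i y • (f i).localNabla δ a v y :=
    fun a v y => finsum_eq_sum_of_support_subset _ fun i hi => by
      rw [ψ.coe_finsupport]
      exact left_ne_zero_of_smul hi
  have hsum : ∀ y, ∑ i ∈ ψ.finsupport y, ψ i y = 1 := fun y => ψ.sum_finsupport y (Set.mem_univ y)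
  have hmem : ∀ y, ∀ i ∈ ψ.finsupport y, ∀ᶠ z in nhds y, (f i).χ z = 1 := fun y i hi =>
    hone i y ((ψ.mem_finsupport y).1 hi)
  have hNf : ∀ (g : C^∞⟮𝓡 n, M; ℝ⟯) a v, N a (fsmul g v) = fsmul g (N a v) := fun g a v => by
    ext y
    simp only [hN, fsmul_apply, DualFrame.localNabla_fsmul_right, Finset.smul_sum, smul_comm (g y)]
  have hNr : ∀ (r : ℝ) a v, N a (r • v) = r • N a v := fun r a v =>
    hNf (ContMDiffMap.const r) a v
  obtain ⟨L, hL⟩ := C.exists_linearMap_endSec (LinearMap.mk₂ ℝ N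
    (fun a b v => by
      ext y
      simp only [hN, Sec.add_apply, DualFrame.localNabla_add_left, smul_add,
        Finset.sum_add_distrib])
    (fun r a v => by
      ext y
      simp only [hN, Sec.smul_apply, DualFrame.localNabla_smul_left, Finset.smul_sum,
        smul_comm r])
    (fun a v w => by
      ext y
      simp only [hN, Sec.add_apply, DualFrame.localNabla_add_right, smul_add,
        Finset.sum_add_distrib])
    (fun r a v => hNr r a v)) hNf
  have hL' : ∀ a (v : Sec n F E) y, L a y (v y) = N a v y := fun a v y =>
    DFunLike.congr_fun (hL a v) y
  refine ⟨⟨L, fun g a y v => ?_, fun a b y v => ?_⟩⟩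
  · obtain ⟨v, rfl⟩ := C.exists_section_eq y v
    rw [hL', hL', hN, hN, Finset.smul_sum, ← one_smul ℝ (C.lie g y (v y) • a y), ← hsum y,
      Finset.sum_smul, ← Finset.sum_add_distrib]
    refine Finset.sum_congr rfl fun i hi => ?_
    rw [(f i).localNabla_fsmul_left δ g a v (hmem y i hi).self_of_nhds]
    module
  · obtain ⟨v, rfl⟩ := C.exists_section_eq y v
    change C.lie (C.pair a b) y (v y) = _
    rw [hL', hL', hN, hN, ← one_mul (C.lie (C.pair a b) y (v y)), ← hsum y, Finset.sum_mul]
    simp only [map_sum, map_smul, _root_.sum_apply, _root_.smul_apply]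
    rw [← Finset.sum_add_distrib]
    refine Finset.sum_congr rfl fun i hi => ?_
    rw [← (f i).localNabla_pairing δ a b v (hmem y i hi)]
    simp only [smul_eq_mul]
    ring

end CourantAlgebroid

/-! ### Connections on the eigenbundles, trace correction, and adapted connections. -/

namespace CourantAlgebroid

variable {C : CourantAlgebroid n F E} [T2Space M] [FiniteDimensional ℝ F]

open GeneralizedMetric

/-- A generalized connection on `V₊` (for `s = 1`) or `V₋` (for `s = -1`), extended by zero to the
complement, that is given by the bracket in the directions of the complement. -/
structure IsHalfConnection (G : C.GeneralizedMetric) (s : ℤˣ)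
    (L : Sec n F E →ₗ[ℝ] EndSec n F E) : Prop where
  mem : ∀ a x v, L a x v ∈ G.V s x
  leibniz : ∀ (f : C^∞⟮𝓡 n, M; ℝ⟯) a x v,
    L (fsmul f a) x v = f x • L a x v + C.lie f x v • G.P s x (a x)
  pairing_parallel : ∀ a b x v, C.lie (C.pair (G.proj s a) (G.proj s b)) x v =
    C.pairing x (L a x v) (b x) + C.pairing x (a x) (L b x v)
  eq_zero : ∀ a, G.IsSec (-s) a → L a = 0
  bracket : ∀ a v, G.IsSec s a → G.IsSec (-s) v → (L a).app v = G.proj s (C.bracket v a)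

namespace IsHalfConnection

variable {G : C.GeneralizedMetric} {L L' : Sec n F E →ₗ[ℝ] EndSec n F E}

/-- The generalized connection assembled from its restrictions to `V₊` and `V₋`. -/
def connection (h : IsHalfConnection G 1 L) (h' : IsHalfConnection G (-1) L') : C.Connection where
  toLin := L + L'
  leibniz f a x v := by
    change L (fsmul f a) x v + L' (fsmul f a) x v = f x • (L a x v + L' a x v) + _
    rw [h.leibniz, h'.leibniz]
    conv_rhs => rw [← G.P_add_P_neg 1 x (a x)]
    module
  pairing_parallel a b x v := by
    have h1 : C.pair a b =
        C.pair (G.proj 1 a) (G.proj 1 b) + C.pair (G.proj (-1) a) (G.proj (-1) b) := by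
      ext y
      change C.pairing y (a y) (b y) = C.pairing y (G.P 1 y (a y)) (G.P 1 y (b y)) +
        C.pairing y (G.P (-1) y (a y)) (G.P (-1) y (b y))
      rw [G.pairing_P, G.pairing_P, G.P_P, G.P_P, ← map_add, G.P_add_P_neg]
    change C.lie (C.pair a b) x v = C.pairing x (L a x v + L' a x v) (b x) +
      C.pairing x (a x) (L b x v + L' b x v)
    rw [h1, lie_add, h.pairing_parallel, h'.pairing_parallel]
    simp only [map_add, _root_.add_apply]
    ring

theorem connection_apply (h : IsHalfConnection G 1 L) (h' : IsHalfConnection G (-1) L')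
    (a : Sec n F E) (x : M) (v : E x) :
    (h.connection h').toLin a x v = L a x v + L' a x v := rfl

theorem isMetric_connection (h : IsHalfConnection G 1 L) (h' : IsHalfConnection G (-1) L') :
    (h.connection h').IsMetric G := by
  intro s a b hb x
  rw [Connection.nabla_apply, connection_apply]
  rcases Int.units_eq_one_or s with rfl | rfl
  · rw [h'.eq_zero b (by rwa [neg_neg])]
    exact Submodule.add_mem _ (h.mem _ _ _) (Submodule.zero_mem _)
  · rw [h.eq_zero b hb]
    exact Submodule.add_mem _ (Submodule.zero_mem _) (h'.mem _ _ _)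

theorem nabla_connection (h : IsHalfConnection G 1 L) (h' : IsHalfConnection G (-1) L')
    {s : ℤˣ} {a b : Sec n F E} (ha : G.IsSec (-s) a) (hb : G.IsSec s b) :
    (h.connection h').nabla a b = G.proj s (C.bracket a b) := by
  ext x
  rw [Connection.nabla_apply, connection_apply]
  rcases Int.units_eq_one_or s with rfl | rfl
  · rw [h'.eq_zero b (by rwa [neg_neg])]
    exact (add_zero _).trans (DFunLike.congr_fun (h.bracket b a hb ha) x)
  · rw [h.eq_zero b hb]
    exact (zero_add _).trans (DFunLike.congr_fun (h'.bracket b a hb ha) x)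

end IsHalfConnection

namespace Connection

variable {D : C.Connection} {G : C.GeneralizedMetric}

theorem torsion_add_left (a a' b c : Sec n F E) (x : M) :
    D.torsion (a + a') b c x = D.torsion a b c x + D.torsion a' b c x := by
  simp [torsion_eq]
  ring

theorem torsion_add_middle (a b b' c : Sec n F E) (x : M) :
    D.torsion a (b + b') c x = D.torsion a b c x + D.torsion a b' c x := by
  simp [torsion_eq]
  ring

theorem torsion_add_right (a b c c' : Sec n F E) (x : M) :
    D.torsion a b (c + c') x = D.torsion a b c x + D.torsion a b c' x := by
  simp [torsion_eq]
  ring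

/-- Each mixed component has one argument in the opposite eigenbundle. In the first slot the bracket
rule kills it, in the second one also uses skewness, in the third invariance carries the bracket
over. -/
theorem IsMetric.isPureType (h : D.IsMetric G)
    (hb : ∀ (s : ℤˣ) (a b : Sec n F E), G.IsSec (-s) a → G.IsSec s b →
      D.nabla a b = G.proj s (C.bracket a b)) : D.IsPureType G := by
  have hb' : ∀ {s : ℤˣ} {a b : Sec n F E} (x : M), G.IsSec (-s) a → G.IsSec s b →
      D.toLin b x (a x) = G.P s x (C.bracket a b x) := fun x ha hbs =>
    DFunLike.congr_fun (hb _ _ _ ha hbs) x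
  have h1 : ∀ {s : ℤˣ} {a b c : Sec n F E} (x : M), G.IsSec (-s) a → G.IsSec s b → G.IsSec s c →
      D.torsion a b c x = 0 := by
    intro s a b c x ha hbs hc
    rw [torsion_eq, hb' x ha hbs, pairing_P_left (hc x),
      pairing_eq_zero' (h.toLin_mem ha x _) (hc x), pairing_eq_zero (hbs x) (h.toLin_mem ha x _)]
    ring
  have h2 : ∀ {s : ℤˣ} {a b c : Sec n F E} (x : M), G.IsSec s a → G.IsSec (-s) b → G.IsSec s c →
      D.torsion a b c x = 0 := by
    intro s a b c x ha hbs hc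
    rw [torsion_eq, hb' x hbs ha, pairing_P_left (hc x),
      pairing_eq_zero' (h.toLin_mem hbs x _) (hc x), pairing_eq_zero' (hbs x) (h.toLin_mem ha x _),
      C.bracket_skew (a := a) fun y => pairing_eq_zero (ha y) (hbs y)]
    simp
  have h3 : ∀ {s : ℤˣ} {a b c : Sec n F E} (x : M), G.IsSec s a → G.IsSec s b → G.IsSec (-s) c →
      D.torsion a b c x = 0 := by
    intro s a b c x ha hbs hc
    have h4 := C.invariance_pair a b c x
    rw [C.lie_congr (f := C.pair b c) (g := fun _ => 0)
      (.of_forall fun y => pairing_eq_zero (hbs y) (hc y)), C.lie_const] at h4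
    rw [torsion_eq, pairing_eq_zero (h.toLin_mem hbs x _) (hc x),
      pairing_eq_zero (h.toLin_mem ha x _) (hc x), hb' x hc ha, pairing_P_right (hbs x),
      C.bracket_skew (a := c) fun y => pairing_eq_zero' (hc y) (ha y)]
    simp only [Sec.neg_apply, map_neg]
    linarith
  have q : ∀ a : Sec n F E, G.IsSec (- -1) (G.proj 1 a) := fun a => by
    rw [neg_neg]; exact isSec_proj 1 a
  intro a b c x
  have ha := isSec_proj (G := G) 1 a
  have hbb := isSec_proj (G := G) 1 b
  have hc := isSec_proj (G := G) 1 c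
  have ha' := isSec_proj (G := G) (-1) a
  have hbb' := isSec_proj (G := G) (-1) b
  have hc' := isSec_proj (G := G) (-1) c
  conv_lhs => rw [← proj_add_proj_neg (G := G) 1 a, ← proj_add_proj_neg (G := G) 1 b,
    ← proj_add_proj_neg (G := G) 1 c]
  simp only [torsion_add_left, torsion_add_middle, torsion_add_right]
  rw [h1 x ha' hbb hc, h2 x ha hbb' hc, h3 x ha hbb hc', h1 x (q a) hbb' hc',
    h2 x ha' (q b) hc', h3 x ha' hbb' (q c)]
  ring

end Connection

variable [SigmaCompactSpace M]

theorem Connection.exists_isHalfConnection (D : C.Connection) (G : C.GeneralizedMetric) (s : ℤˣ) :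
    ∃ L, IsHalfConnection G s L := by
  -- The bracket part is tensorial in `v`: the derivative of a coefficient multiplies `v_{-s}`,
  -- which the outer projection kills.
  let N (a v : Sec n F E) : Sec n F E := G.proj s (C.bracket (G.proj (-s) v) (G.proj s a)) +
    G.proj s (D.nabla (G.proj s v) (G.proj s a))
  have horth : ∀ (a v : Sec n F E) y, C.pairing y (G.proj (-s) v y) (G.proj s a y) = 0 :=
    fun a v y => pairing_eq_zero' (isSec_proj _ _ y) (isSec_proj _ _ y)
  have hNf : ∀ (g : C^∞⟮𝓡 n, M; ℝ⟯) a v, N a (fsmul g v) = fsmul g (N a v) := fun g a v => by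
    ext y
    simp only [N, proj_fsmul, Sec.add_apply, proj_apply, C.fsmul_bracket (horth a v),
      Connection.nabla_fsmul, map_sub, map_smul, fsmul_apply, P_P_neg, smul_zero, sub_zero,
      smul_add]
  obtain ⟨L, hL⟩ := C.exists_linearMap_endSec (LinearMap.mk₂ ℝ N
    (fun a b v => by
      ext y
      simp [N, proj_add]
      abel)
    (fun r a v => by
      ext y
      simp [N, proj_smul])
    (fun a v w => by
      ext y
      simp [N, proj_add]
      abel)
    (fun r a v => hNf (ContMDiffMap.const r) a v)) hNf
  have hL' : ∀ a (v : Sec n F E) y, L a y (v y) = N a v y := fun a v y =>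
    DFunLike.congr_fun (hL a v) y
  refine ⟨L, fun a x v => ?_, fun f a x v => ?_, fun a b x v => ?_, fun a ha => ?_,
    fun a v ha hv => ?_⟩
  · obtain ⟨v, rfl⟩ := C.exists_section_eq x v
    rw [hL']
    exact ((isSec_proj _ _).add (isSec_proj _ _)) x
  · obtain ⟨v, rfl⟩ := C.exists_section_eq x v
    rw [hL', hL']
    simp only [N, proj_fsmul, Sec.add_apply, proj_apply, C.bracket_fsmul, Connection.nabla_apply,
      D.leibniz, map_add, map_smul, P_P]
    have hv : C.lie f x (v x) = C.lie f x (G.P s x (v x)) + C.lie f x (G.P (-s) x (v x)) := by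
      rw [← lie_add_right, G.P_add_P_neg]
    rw [hv]
    module
  · obtain ⟨v, rfl⟩ := C.exists_section_eq x v
    rw [hL', hL']
    have h1 := C.invariance_pair (G.proj (-s) v) (G.proj s a) (G.proj s b) x
    have h2 := D.pairing_parallel (G.proj s a) (G.proj s b) x (G.proj s v x)
    change C.lie (C.pair _ _) _ _ = _ at h2
    conv_lhs => rw [← proj_add_proj_neg (G := G) s v, Sec.add_apply, lie_add_right, h1, h2]
    simp only [N, Sec.add_apply, map_add, _root_.add_apply, proj_apply, Connection.nabla_apply,
      pairing_P]
    ring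
  · refine EndSec_ext C fun v => ?_
    rw [hL]
    change N a v = 0
    simp only [N, ha.proj_of_neg]
    ext y
    simp
  · rw [hL]
    change N a v = _
    simp only [N, ha.proj_eq, hv.proj_eq, hv.proj_of_neg]
    ext y
    simp

theorem trace_P (G : C.GeneralizedMetric) (s : ℤˣ) (x : M) :
    LinearMap.trace ℝ (E x) (G.P s x) = finrank ℝ (G.V s x) := by
  have := finite_fiber (F := F) (E := E) x
  exact LinearMap.IsProj.trace ⟨P_mem s x, fun v hv => P_of_mem hv⟩

/-- Divergence and trace obey the same Leibniz rule on `V_s`, so the defect `φ` is tensorial and is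
represented by some `u`, which lies in `V_s` because `φ` vanishes on `V_{-s}`. -/
theorem IsHalfConnection.exists_trace_eq {G : C.GeneralizedMetric} {s : ℤˣ}
    {L : Sec n F E →ₗ[ℝ] EndSec n F E} (h : IsHalfConnection G s L) (δ : C.Divergence)
    (hs : ∀ x, finrank ℝ (G.V s x) ≠ 1) :
    ∃ L', IsHalfConnection G s L' ∧ ∀ a x,
      LinearMap.trace ℝ (E x) (L' a x : E x →ₗ[ℝ] E x) = δ.toLin (G.proj s a) x := by
  have hfst : ∀ (f : C^∞⟮𝓡 n, M; ℝ⟯) a x,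
      LinearMap.trace ℝ (E x) (L (fsmul f a) x : E x →ₗ[ℝ] E x) =
        f x * LinearMap.trace ℝ (E x) (L a x : E x →ₗ[ℝ] E x) +
          C.lie f x (G.P s x (a x)) := by
    intro f a x
    have := finite_fiber (F := F) (E := E) x
    let l : E x →ₗ[ℝ] ℝ := IsLinearMap.mk' (C.lie f x) ⟨fun v w => C.lie_add_right f x v w,
      fun r v => C.lie_smul_right f x r v⟩
    have h1 : (L (fsmul f a) x : E x →ₗ[ℝ] E x) =
        f x • (L a x : E x →ₗ[ℝ] E x) + l.smulRight (G.P s x (a x)) := by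
      ext v; exact h.leibniz f a x v
    rw [h1, map_add, map_smul, LinearMap.trace_smulRight]
    rfl
  let φ : Sec n F E →ₗ[ℝ] C^∞⟮𝓡 n, M; ℝ⟯ :=
    { toFun := fun a => δ.toLin (G.proj s a) - C.traceMap (L a)
      map_add' := fun a b => by
        have h1 : C.traceMap (L (a + b)) = C.traceMap (L a) + C.traceMap (L b) := by
          ext x
          rw [map_add]
          exact map_add (LinearMap.trace ℝ (E x)) (L a x : E x →ₗ[ℝ] E x) (L b x : E x →ₗ[ℝ] E x)
        rw [proj_add, map_add, h1]
        abel
      map_smul' := fun r a => by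
        have h1 : C.traceMap (L (r • a)) = r • C.traceMap (L a) := by
          ext x
          rw [map_smul]
          exact map_smul (LinearMap.trace ℝ (E x)) r (L a x : E x →ₗ[ℝ] E x)
        rw [proj_smul, map_smul, h1, RingHom.id_apply, smul_sub] }
  have hφ : ∀ a x, φ a x = δ.toLin (G.proj s a) x -
      LinearMap.trace ℝ (E x) (L a x : E x →ₗ[ℝ] E x) := fun a x => rfl
  have hφf : ∀ (f : C^∞⟮𝓡 n, M; ℝ⟯) a, φ (fsmul f a) = f * φ a := by
    intro f a
    ext x
    change _ = f x * φ a x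
    rw [hφ, hφ, hfst, proj_fsmul, δ.leibniz]
    simp only [proj_apply]
    ring
  have hφ0 : ∀ a, G.IsSec (-s) a → φ a = 0 := by
    intro a ha
    ext x
    rw [hφ, ha.proj_of_neg, h.eq_zero a ha, map_zero]
    change 0 - LinearMap.trace ℝ (E x) 0 = 0
    simp
  have hφP : ∀ a, φ (G.proj s a) = φ a := by
    intro a
    conv_rhs => rw [← proj_add_proj_neg (G := G) s a, map_add, hφ0 _ (isSec_proj _ _), add_zero]
  obtain ⟨u, hu⟩ := C.exists_section_pairing φ hφf
  have hu' : ∀ (a : Sec n F E) x, C.pairing x (u x) (a x) = φ a x := fun a x =>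
    DFunLike.congr_fun (hu a) x
  have huV : ∀ x, u x ∈ G.V s x := by
    intro x
    rw [G.mem_V_iff]
    refine C.eq_of_pairing_section fun c => ?_
    rw [G.pairing_P, ← proj_apply, hu', hu', hφP]
  -- The rank enters as the trace of the projection, a smooth function, so that `1 / (r - 1)` is
  -- smooth.
  obtain ⟨B, hB⟩ := C.exists_endSec
    { toFun := G.proj s, map_add' := proj_add s, map_smul' := proj_smul s } (proj_fsmul s)
  have hBP : ∀ x, (B x : E x →ₗ[ℝ] E x) = G.P s x := by
    intro x
    ext v
    obtain ⟨v, rfl⟩ := C.exists_section_eq x v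
    exact DFunLike.congr_fun (hB v) x
  have hr : ∀ x, C.traceMap B x - 1 = (finrank ℝ (G.V s x) : ℝ) - 1 := by
    intro x
    rw [traceMap_apply, hBP, trace_P]
  have hr0 : ∀ x, C.traceMap B x - 1 ≠ 0 := by
    intro x
    rw [hr, sub_ne_zero]
    exact_mod_cast hs x
  let c : C^∞⟮𝓡 n, M; ℝ⟯ := ⟨fun x => (C.traceMap B x - 1)⁻¹,
    ((C.traceMap B).contMDiff.sub contMDiff_const).inv₀ hr0⟩
  have hc : ∀ x, c x * ((finrank ℝ (G.V s x) : ℝ) - 1) = 1 := fun x => by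
    rw [← hr]
    exact inv_mul_cancel₀ (hr0 x)
  -- Skew in the pairing, as `⟨N a v, b⟩` is proportional to `φ(a)⟨v,b⟩ - φ(b)⟨v,a⟩` on `V_s`, and
  -- zero for `v` in `V_{-s}`, so mixed derivatives are unchanged. Its trace in `v` is `c (r - 1)
  -- φ(a) = φ(a)`.
  let N (a v : Sec n F E) : Sec n F E :=
    fsmul c (fsmul (φ a) (G.proj s v) - fsmul (C.pair (G.proj s v) a) u)
  have hN : ∀ a v x, N a v x =
      c x • (φ a x • G.P s x (v x) - C.pairing x (G.P s x (v x)) (a x) • u x) := fun a v x => rfl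
  have hNf : ∀ (g : C^∞⟮𝓡 n, M; ℝ⟯) a v, N a (fsmul g v) = fsmul g (N a v) := by
    intro g a v
    ext x
    simp only [hN, fsmul_apply, map_smul, _root_.smul_apply, smul_eq_mul]
    module
  obtain ⟨Q, hQ⟩ := C.exists_linearMap_endSec (LinearMap.mk₂ ℝ N
    (fun a b v => by
      ext x
      have : φ (a + b) x = φ a x + φ b x := by rw [map_add]; rfl
      rw [hN, this]
      simp only [hN, Sec.add_apply, map_add]
      module)
    (fun r a v => by
      ext x
      have : φ (r • a) x = r * φ a x := by rw [map_smul]; rfl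
      rw [hN, this]
      simp only [hN, Sec.smul_apply, map_smul, smul_eq_mul]
      module)
    (fun a v w => by
      ext x
      simp only [hN, Sec.add_apply, map_add, _root_.add_apply]
      module)
    (fun r a v => hNf (ContMDiffMap.const r) a v)) hNf
  have hQ' : ∀ a x (v : E x), Q a x v =
      c x • (φ a x • G.P s x v - C.pairing x (G.P s x v) (a x) • u x) := by
    intro a x v
    obtain ⟨v, rfl⟩ := C.exists_section_eq x v
    exact DFunLike.congr_fun (hQ a v) x
  have hadd : ∀ a x (v : E x), (L + Q) a x v = L a x v + Q a x v := fun _ _ _ => rfl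
  refine ⟨L + Q, ⟨fun a x v => ?_, fun f a x v => ?_, fun a b x v => ?_, fun a ha => ?_,
    fun a v ha hv => ?_⟩, fun a x => ?_⟩
  · rw [hadd, hQ']
    exact Submodule.add_mem _ (h.mem a x v) (Submodule.smul_mem _ _ (Submodule.sub_mem _
      (Submodule.smul_mem _ _ (P_mem s x v)) (Submodule.smul_mem _ _ (huV x))))
  · rw [hadd, hadd, hQ', hQ', h.leibniz, hφf]
    have : (f * φ a) x = f x * φ a x := rfl
    simp only [this, fsmul_apply, map_smul, smul_eq_mul]
    module
  · rw [hadd, hadd, hQ', hQ', h.pairing_parallel]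
    simp only [map_add, map_sub, map_smul, _root_.add_apply, _root_.sub_apply, _root_.smul_apply,
      smul_eq_mul, hu', C.pairing_symm x (a x)]
    ring
  · refine EndSec_ext C fun v => ?_
    ext x
    have h1 : L a x (v x) = 0 := by rw [h.eq_zero a ha]; rfl
    have h2 : φ a x = 0 := by rw [hφ0 a ha]; rfl
    change (L + Q) a x (v x) = 0
    rw [hadd, hQ', h1, h2, pairing_eq_zero (P_mem s x _) (ha x)]
    simp
  · rw [← h.bracket a v ha hv]
    ext x
    change (L + Q) a x (v x) = L a x (v x)
    rw [hadd, hQ', P_of_mem_neg (hv x)]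
    simp
  · have := finite_fiber (F := F) (E := E) x
    have h1 : ((L + Q) a x : E x →ₗ[ℝ] E x) = (L a x : E x →ₗ[ℝ] E x) +
        c x • (φ a x • G.P s x - (C.form x (G.P s x (a x))).smulRight (u x)) := by
      ext v
      refine (hadd a x v).trans ?_
      rw [hQ', G.pairing_P, C.pairing_symm]
      rfl
    rw [h1, map_add, map_smul, map_sub, map_smul, trace_P, LinearMap.trace_smulRight, form_apply,
      ← proj_apply, C.pairing_symm, hu', hφP, smul_eq_mul, smul_eq_mul]
    have h2 := hφ a x
    linear_combination φ a x * hc x + h2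

theorem exists_isAdapted (G : C.GeneralizedMetric) (δ : C.Divergence)
    (hG : ∀ (s : ℤˣ) (x : M), finrank ℝ (G.V s x) ≠ 1) : ∃ D : C.Connection, D.IsAdapted G δ := by
  obtain ⟨D₀⟩ := δ.nonempty_connection
  obtain ⟨L₀, h₀⟩ := D₀.exists_isHalfConnection G 1
  obtain ⟨L₀', h₀'⟩ := D₀.exists_isHalfConnection G (-1)
  obtain ⟨L, h, hL⟩ := h₀.exists_trace_eq δ (hG 1)
  obtain ⟨L', h', hL'⟩ := h₀'.exists_trace_eq δ (hG (-1))
  have hm := h.isMetric_connection h'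
  refine ⟨h.connection h', hm, hm.isPureType fun s a b => h.nabla_connection h', fun a x => ?_⟩
  have h1 : ((h.connection h').toLin a x : E x →ₗ[ℝ] E x) =
      (L a x : E x →ₗ[ℝ] E x) + (L' a x : E x →ₗ[ℝ] E x) := rfl
  rw [h1, map_add, hL, hL']
  conv_lhs => rw [← proj_add_proj_neg (G := G) 1 a, map_add]
  rfl

end CourantAlgebroid

end CourantRicci

end

theorem mainTheorem3 {n : ℕ} {M : Type*} [TopologicalSpace M] [T2Space M] [SigmaCompactSpace M]
    [ChartedSpace (EuclideanSpace ℝ (Fin n)) M] [IsManifold (𝓡 n) ∞ M]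
    {F : Type*} [NormedAddCommGroup F] [NormedSpace ℝ F] [FiniteDimensional ℝ F]
    {E : M → Type*} [TopologicalSpace (TotalSpace F E)]
    [∀ x, AddCommGroup (E x)] [∀ x, Module ℝ (E x)] [∀ x, TopologicalSpace (E x)]
    [∀ x, IsTopologicalAddGroup (E x)] [∀ x, ContinuousSMul ℝ (E x)]
    [FiberBundle F E] [VectorBundle ℝ F E] [ContMDiffVectorBundle ∞ F E (𝓡 n)]
    (C : CourantRicci.CourantAlgebroid n F E) (G : C.GeneralizedMetric) (δ : C.Divergence) :
    -- the generalized Ricci curvature of the pair `(G, δ)` is well defined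
    ((∀ (s : ℤˣ) (x : M), finrank ℝ (G.V s x) ≠ 1) →
      ∃ D : C.Connection, D.IsAdapted G δ) ∧
    (∀ D D' : C.Connection, D.IsAdapted G δ → D'.IsAdapted G δ →
      (∀ s, D.ricciGF G s = D'.ricciGF G s) ∧ D.ricci G = D'.ricci G) ∧
    -- it is the sum of its two parts, and it is symmetric exactly when the pair is compatible
    (∀ D : C.Connection, D.IsAdapted G δ →
      (∀ a b, D.ricci G a b = D.ricciGF G 1 a b + D.ricciGF G (-1) a b) ∧
      ((∀ a b, D.ricci G a b = D.ricci G b a) ↔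
        CourantRicci.CourantAlgebroid.IsCompatible G δ)) :=
  ⟨CourantRicci.CourantAlgebroid.exists_isAdapted G δ,
    fun _ _ h h' => ⟨h.ricciGF_congr h', h.ricci_congr h'⟩,
    fun _ h => ⟨h.isMetric.ricci_eq, h.ricci_symm_iff⟩⟩
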